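/- Let $M_0$ be a compact one-dimensional $C^2$-manifold without boundary (not necessarily connected), $u : M_0 \to \mathbb{R}^n$ a $C^2$ immersion, and $\mu_0$ a Borel probability measure on $M_0$. Endow $M_0$ with the Riemannian metric induced by $u$. For $x_0, y_0 \in M_0$ write $x = u(x_0)$, $y = u(y_0)$, and let $T_{x_0} = d_{x_0}u(T_{x_0}M_0) \subset \mathbb{R}^n$ be the tangent line of the branch through $x_0$. Assume: 1. if $x_0 \neq y_0$ and $x = y$, then $T_{x_0} \neq T_{y_0}$; 2. the operator norm of the second fundamental form of $M_0$ at each point is at most $\rho$, where $\rho > 0$; 3. $\mu_0$ has a density $f_0$ with respect to $\mathcal{H}^1_{M_0}$, the one-dimensional Hausdorff measure of $\mathbb{R}^n$ pulled back by $u$, i.e. $\mathcal{H}^1_{M_0}(A) = \int_{\mathbb{R}^n} \#(A \cap u^{-1}(y))\, d\mathcal{H}^1(y)$; moreover $f_0$ is Lipschitz for the geodesic distance and $f_{\min} \le f_0 \le f_{\max}$ for constants $f_{\min}, f_{\max} > 0$. The normal reach at $x_0 \in M_0$ is $\lambda_0(x_0) = \inf \{ \|x-y\| : y_0 \in M_0,\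 y_0 \neq x_0,\ x - y \perp T_{y_0} \}$. For $r \ge 0$ let $\lambda_0^r = \{x_0 \in M_0 : \lambda_0(x_0) \le r\}$. Let - $\mathcal{D}_0 = \{(x_0,y_0) \in M_0 \times M_0 : x_0 \neq y_0,\ x - y \perp T_{x_0},\ x-y \perp T_{y_0}\}$ and $\mathcal{C}_0 = \{(x_0,y_0) \in M_0 \times M_0 : x_0 \neq y_0,\ x = y\}$; - $\Theta$ be the infimum, over $(x_0,y_0) \in \mathcal{C}_0$, of the angle in $[0,\pi/2]$ between the lines $T_{x_0}$ and $T_{y_0}$ (with $\Theta = \pi/2$ if $\mathcal{C}_0 = \emptyset$); - $\Delta = \inf\{\|x-y\| : (x_0,y_0) \in \mathcal{D}_0 \setminus \mathcal{C}_0\}$ (with $\inf\emptyset = +\infty$); - $C_0 = \{x_0 \in M_0 : \lambda_0(x_0) = 0\}$ be the set of self-intersection points, and $|C_0|$ its cardinality. Then $C_0$ is finite, $\Theta > 0$, $\Delta > 0$, and for every $r \ge 0$ with $r < \Delta \wedge \frac{\sin(\Theta)^2}{4\rho}$, $$\mu_0(\lambda_0^r) \le c\, r, \qquad c = |C_0|\,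 f_{\max}\, J_{\max}\, V_1 \cdot \frac{2}{\sin \Theta},$$ where $J_{\max} = \frac54$ and $V_1 = \mathcal{H}^1([-1,1]) = 2$. In particular, there are $c' \ge 0$ and $r' > 0$ such that $\mu_0(\lambda_0^r) \le c' r$ for all $r \in [0, r')$. -/

import Mathlib

open MeasureTheory Set
open scoped Manifold ENNReal NNReal ContDiff

noncomputable section

namespace ImmersedCurve

/-- The Euclidean space `ℝⁿ`. -/
abbrev Euc (n : ℕ) : Type := EuclideanSpace ℝ (Fin n)

section
variable {n : ℕ} {M : Type*} [TopologicalSpace M] [ChartedSpace ℝ M]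

/-- The differential of `u` at `x`, applied to a tangent vector of the one-dimensional manifold `M`
(the tangent space of `M` at `x` is `ℝ`, through the preferred chart at `x`). -/
def diff (u : M → Euc n) (x : M) (v : ℝ) : Euc n :=
  mfderiv 𝓘(ℝ, ℝ) 𝓘(ℝ, Euc n) u x v

/-- `u` is an immersion of class `C²`. -/
def IsC2Immersion (u : M → Euc n) : Prop :=
  ContMDiff 𝓘(ℝ, ℝ) 𝓘(ℝ, Euc n) 2 u ∧ ∀ x, Function.Injective (diff u x)

/-- The (direction of the) tangent line at `u x` of the branch through `x`, i.e. the image of the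
tangent space of `M` at `x` under the differential of `u`. -/
def tangentLine (u : M → Euc n) (x : M) : Submodule ℝ (Euc n) :=
  Submodule.span ℝ (range (diff u x))

/-- Hypothesis: distinct points with the same image have distinct tangent lines. -/
def TransverseSelfIntersections (u : M → Euc n) : Prop :=
  ∀ x y, x ≠ y → u x = u y → tangentLine u x ≠ tangentLine u y

/-- The second fundamental form at `x`, by the Gauss formula in the preferred chart at `x`: the
component normal to the tangent line of the second derivative of `u` read in the chart. -/
def secondFundamentalForm (u : M → Euc n) (x : M) (v w : ℝ) : Euc n :=
  (tangentLine u x)ᗮ.starProjection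
    (fderiv ℝ (fderiv ℝ (u ∘ (extChartAt 𝓘(ℝ, ℝ) x).symm)) (extChartAt 𝓘(ℝ, ℝ) x x) v w)

/-- Hypothesis: the operator norm of the second fundamental form, for the metric induced by `u`
(for which a tangent vector `v` has norm `‖diff u x v‖`), is at most `ρ` at each point. -/
def CurvatureBoundedBy (u : M → Euc n) (ρ : ℝ) : Prop :=
  ∀ x v w, ‖secondFundamentalForm u x v w‖ ≤ ρ * ‖diff u x v‖ * ‖diff u x w‖

/-- The geodesic distance for the Riemannian metric induced by `u`: the infimum of the lengths of
the `C¹` paths from `x` to `y` (it is `∞` between distinct connected components). -/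
def geodesicEDist (u : M → Euc n) (x y : M) : ℝ≥0∞ :=
  letI : ∀ z : M, ENorm (TangentSpace 𝓘(ℝ, ℝ) z) := fun z => ⟨fun v => ‖diff u z v‖ₑ⟩
  Manifold.riemannianEDist 𝓘(ℝ, ℝ) x y

/-- The one-dimensional Hausdorff measure of `ℝⁿ` pulled back by `u`: the measure of `A` is the
integral over `y ∈ ℝⁿ` of the number of preimages of `y` in `A`, with respect to the
one-dimensional Hausdorff measure. -/
def pullbackHausdorff [MeasurableSpace M] (u : M → Euc n) : Measure M :=
  (Measure.hausdorffMeasure 1 : Measure (Euc n)).bind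
    (fun y => Measure.count.restrict (u ⁻¹' {y}))

/-- Hypothesis: `μ₀` has a density with respect to the pulled back Hausdorff measure, which is
`L`-Lipschitz for the geodesic distance and takes its values in `[fmin, fmax]`. -/
def HasLipschitzDensity [MeasurableSpace M] (u : M → Euc n) (μ₀ : Measure M)
    (L : ℝ≥0) (fmin fmax : ℝ) : Prop :=
  ∃ f : M → ℝ,
    μ₀ = (pullbackHausdorff u).withDensity (fun x => ENNReal.ofReal (f x)) ∧
    (∀ x y, edist (f x) (f y) ≤ L * geodesicEDist u x y) ∧
    ∀ x, fmin ≤ f x ∧ f x ≤ fmax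

/-- The normal reach at `x`: the infimum of `‖u x - u y‖` over the points `y ≠ x` such that
`u x - u y` is orthogonal to the tangent line at `y`. -/
def normalReach (u : M → Euc n) (x : M) : ℝ≥0∞ :=
  ⨅ (y : M) (_ : y ≠ x ∧ u x - u y ∈ (tangentLine u y)ᗮ), edist (u x) (u y)

/-- The set of points of normal reach at most `r`. -/
def normalReachSublevel (u : M → Euc n) (r : ℝ) : Set M :=
  {x | normalReach u x ≤ ENNReal.ofReal r}

/-- The self-intersection points: the points of `M` of zero normal reach. -/
def selfIntersectionPoints (u : M → Euc n) : Set M :=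
  {x | normalReach u x = 0}

/-- The pairs of distinct points of `M` that are critical for the Euclidean distance. -/
def criticalPairs (u : M → Euc n) : Set (M × M) :=
  {p | p.1 ≠ p.2 ∧ u p.1 - u p.2 ∈ (tangentLine u p.2)ᗮ ∧ u p.1 - u p.2 ∈ (tangentLine u p.1)ᗮ}

/-- The pairs of distinct points of `M` with the same image. -/
def selfIntersectionPairs (u : M → Euc n) : Set (M × M) :=
  {p | p.1 ≠ p.2 ∧ u p.1 = u p.2}

/-- The angle in `[0, π/2]` between the tangent lines at `x` and `y`. -/
def tangentAngle (u : M → Euc n) (x y : M) : ℝ :=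
  min (InnerProductGeometry.angle (diff u x 1) (diff u y 1))
    (Real.pi - InnerProductGeometry.angle (diff u x 1) (diff u y 1))

/-- The smallest angle at a self-intersection. As these angles lie in `[0, π/2]`, adding `π/2` to
the set changes the infimum only if there is no self-intersection; it is then `π/2`. -/
def minAngle (u : M → Euc n) : ℝ :=
  sInf (insert (Real.pi / 2) ((fun p : M × M => tangentAngle u p.1 p.2) '' selfIntersectionPairs u))

/-- The infimum of `‖u x - u y‖` over the critical pairs that are not self-intersections. -/
def minCriticalDist (u : M → Euc n) : ℝ≥0∞ :=
  ⨅ p ∈ criticalPairs u \ selfIntersectionPairs u, edist (u p.1) (u p.2)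

end

/-- The upper bound `(5/4)ᵈ` for the Jacobian of the exponential map, for `d = 1`. -/
def Jmax : ℝ := 5 / 4

/-- The length of the unit ball of the real line. -/
def unitBallVolume : ℝ := 2

/-- The constant of the linear bound for the measure of the points of small normal reach. -/
def reachConstant {n : ℕ} {M : Type*} [TopologicalSpace M] [ChartedSpace ℝ M]
    (u : M → Euc n) (fmax : ℝ) : ℝ :=
  (selfIntersectionPoints u).ncard * fmax * Jmax * unitBallVolume * (2 / Real.sin (minAngle u))

end ImmersedCurve

end

noncomputable section

open Filter Topology

namespace ImmersedCurve

/-! ### Reading `u` in charts; lifting real curves through an immersion. -/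

section
variable {n : ℕ} {M : Type*} [TopologicalSpace M] [ChartedSpace ℝ M]

/-! Everything is computed along complete unit-speed arcs of `M`, one through each point
(`IsC2Immersion.exists_arc`). The curvature bound makes the velocity `ρ`-Lipschitz, so `u` along an
arc stays within `ρ/2 * t²` of its tangent line (`IsArc.norm_taylor_le`).

Two regions of `M × M` are then understood. In the tube of pairs joined by an arc of length less
than `1/ρ`, no pair of distinct points competes in the normal reach. In a square around a
self-intersection, with arc parameters less than `σ/(2ρ)` where `σ = sin Θ`, the branches separate
at least at rate `σ/2` (`IsArc.crossing_le`), and the only critical pair is the crossing itself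
(`IsArc.norm_le_of_critical`). Self-intersections are therefore isolated, and finite in number by
compactness.

The remaining pairs form the compact set `farPairs`, on which the distance is positive; hence `Δ >
0`. If the distance took a value at most `r` there, its minimum over `farPairs` would be a local
minimum on `M × M`, hence a critical pair that is not a self-intersection, contradicting `r < Δ`
(`exists_mem_closedSquare`). So every pair at distance at most `r` outside the tube is within arc
parameter `2r/σ` of a self-intersection. The points of normal reach at most `r` are thus covered, up
to an arbitrarily small enlargement of `r`, by one arc of length `4r/σ` per point of `C₀`, and the
density bound concludes. -/

/-- The chart of `M` preferred at `x`, with values in `ℝ`. -/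
abbrev chart (x : M) : PartialEquiv M ℝ := extChartAt 𝓘(ℝ, ℝ) x

/-- The map `u` read in the preferred chart at `x`. -/
def chartRep (u : M → Euc n) (x : M) : ℝ → Euc n := u ∘ (chart x).symm

theorem isOpen_chart_target (x : M) : IsOpen (chart x).target :=
  isOpen_extChartAt_target x

theorem IsC2Immersion.contDiffOn_chartRep [IsManifold 𝓘(ℝ, ℝ) 2 M] {u : M → Euc n}
    (hu : IsC2Immersion u) (x : M) : ContDiffOn ℝ 2 (chartRep u x) (chart x).target :=
  contMDiffOn_iff_contDiffOn.1 (hu.1.comp_contMDiffOn (contMDiffOn_extChartAt_symm x))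

theorem IsC2Immersion.contDiffAt_chartRep [IsManifold 𝓘(ℝ, ℝ) 2 M] {u : M → Euc n}
    (hu : IsC2Immersion u) {x : M} {w : ℝ} (hw : w ∈ (chart x).target) :
    ContDiffAt ℝ 2 (chartRep u x) w :=
  (hu.contDiffOn_chartRep x).contDiffAt ((isOpen_chart_target x).mem_nhds hw)

theorem IsC2Immersion.diff_eq [IsManifold 𝓘(ℝ, ℝ) 2 M] {u : M → Euc n}
    (hu : IsC2Immersion u) (x : M) (v : ℝ) :
    diff u x v = v • deriv (chartRep u x) (chart x x) := by
  have h : MDifferentiableAt 𝓘(ℝ, ℝ) 𝓘(ℝ, Euc n) u x :=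
    (hu.1 x).mdifferentiableAt (by norm_num)
  unfold diff
  rw [h.mfderiv]
  simp only [modelWithCornersSelf_coe, range_id, fderivWithin_univ]
  have : writtenInExtChartAt 𝓘(ℝ, ℝ) 𝓘(ℝ, Euc n) x u = chartRep u x := by
    ext; simp [writtenInExtChartAt, chartRep, chart]; rfl
  rw [this]
  exact (fderiv_eq_smul_deriv (𝕜 := ℝ) (f := chartRep u x) (x := chart x x) v)

theorem IsC2Immersion.deriv_chartRep_ne_zero [IsManifold 𝓘(ℝ, ℝ) 2 M] {u : M → Euc n}
    (hu : IsC2Immersion u) (x : M) : deriv (chartRep u x) (chart x x) ≠ 0 := by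
  intro h
  have : (1 : ℝ) = 0 := hu.2 x (by rw [hu.diff_eq, hu.diff_eq, h]; simp)
  exact one_ne_zero this

theorem IsC2Immersion.tangentLine_eq [IsManifold 𝓘(ℝ, ℝ) 2 M] {u : M → Euc n}
    (hu : IsC2Immersion u) (x : M) :
    tangentLine u x = Submodule.span ℝ {deriv (chartRep u x) (chart x x)} := by
  unfold tangentLine
  apply le_antisymm
  · rw [Submodule.span_le]
    rintro _ ⟨v, rfl⟩
    rw [hu.diff_eq]
    exact Submodule.smul_mem _ _ (Submodule.mem_span_singleton_self _)
  · rw [Submodule.span_singleton_le_iff_mem]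
    apply Submodule.subset_span
    exact ⟨1, by rw [hu.diff_eq, one_smul]⟩

theorem IsC2Immersion.secondFundamentalForm_eq [IsManifold 𝓘(ℝ, ℝ) 2 M] {u : M → Euc n}
    (hu : IsC2Immersion u) (x : M) :
    secondFundamentalForm u x 1 1 =
      (tangentLine u x)ᗮ.starProjection (deriv (deriv (chartRep u x)) (chart x x)) := by
  unfold secondFundamentalForm
  congr 1
  change fderiv ℝ (fderiv ℝ (chartRep u x)) (chart x x) 1 1 = _
  have hx : chart x x ∈ (chart x).target := mem_extChartAt_target x
  have h : ContDiffAt ℝ 1 (fderiv ℝ (chartRep u x)) (chart x x) :=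
    (hu.contDiffAt_chartRep hx).fderiv_right (by norm_num)
  have h' := (h.differentiableAt (by norm_num)).hasFDerivAt.hasDerivAt
  have := (h'.clm_apply (hasDerivAt_const (chart x x) (1 : ℝ)))
  have := this.deriv
  simpa using this.symm

/-- A lift of a differentiable curve through an immersed curve is differentiable. -/
theorem exists_hasDerivAt_of_comp {E : Type*} [NormedAddCommGroup E] [InnerProductSpace ℝ E]
    {h : ℝ → E} {w : ℝ → ℝ} {t : ℝ} {F v : E} (hh : HasStrictDerivAt h F (w t)) (hF : F ≠ 0)
    (hw : ContinuousAt w t) (hv : HasDerivAt (h ∘ w) v t) :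
    ∃ w', HasDerivAt w w' t ∧ v = w' • F := by
  -- Pairing with `F` turns `h` into a real function with derivative `‖F‖² ≠ 0`, whose local inverse
  -- recovers `w` from `h ∘ w`.
  have hk : HasStrictDerivAt (fun x => inner ℝ F (h x)) (inner ℝ F F) (w t) := by
    exact (innerSL ℝ F).hasStrictFDerivAt.comp_hasStrictDerivAt (w t) hh
  have hF' : inner ℝ F F ≠ 0 := inner_self_ne_zero.2 hF
  have hg := hk.to_localInverse hF'
  set g := hk.localInverse _ _ _ hF'
  have hgk : ∀ᶠ x in 𝓝 (w t), g (inner ℝ F (h x)) = x :=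
    (hk.hasStrictFDerivAt_equiv hF').eventually_left_inverse
  have hkv : HasDerivAt (fun s => inner ℝ F (h (w s))) (inner ℝ F v) t := by
    exact (innerSL ℝ F).hasFDerivAt.comp_hasDerivAt t hv
  have h1 := hg.hasDerivAt.comp t hkv
  have h2 : HasDerivAt w _ t := h1.congr_of_eventuallyEq
    ((hw.eventually hgk).mono fun s hs => hs.symm)
  exact ⟨_, h2, hv.unique (hh.hasDerivAt.scomp t h2)⟩

/-- Differentiability is needed only at `t`: it puts values of `w` strictly on both sides of `w t`
at nearby times, and the intermediate value theorem fills in between. -/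
theorem nhds_le_map_of_hasDerivAt_pos {w : ℝ → ℝ} {t w' : ℝ} (hw : ∀ᶠ s in 𝓝 t, ContinuousAt w s)
    (h : HasDerivAt w w' t) (hw' : 0 < w') : 𝓝 (w t) ≤ map w (𝓝 t) := by
  intro A hA
  rw [mem_map] at hA
  have h1 : ∀ᶠ s in 𝓝[>] t, w t < w s := by
    have := (hasDerivAt_iff_tendsto_slope.1 h).eventually (lt_mem_nhds hw')
    have := this.filter_mono (nhdsWithin_mono t (fun s (hs : t < s) => hs.ne'))
    filter_upwards [this, self_mem_nhdsWithin] with s hs hts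
    exact (slope_pos_iff_of_le (le_of_lt hts)).1 hs
  have h2 : ∀ᶠ s in 𝓝[<] t, w s < w t := by
    have := (hasDerivAt_iff_tendsto_slope.1 h).eventually (lt_mem_nhds hw')
    have := this.filter_mono (nhdsWithin_mono t (fun s (hs : s < t) => hs.ne))
    filter_upwards [this, self_mem_nhdsWithin] with s hs hts
    rw [slope_comm] at hs
    exact (slope_pos_iff_of_le (le_of_lt hts)).1 hs
  obtain ⟨κ, hκ, hκA⟩ := Metric.eventually_nhds_iff.1 (hw.and hA)
  have h1' : ∀ᶠ s in 𝓝[>] t, s < t + κ :=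
    mem_nhdsWithin_of_mem_nhds (Iio_mem_nhds (by linarith))
  have h2' : ∀ᶠ s in 𝓝[<] t, t - κ < s :=
    mem_nhdsWithin_of_mem_nhds (Ioi_mem_nhds (by linarith))
  obtain ⟨b, ⟨hb1, hb2⟩, hb3⟩ := ((h1.and h1').and self_mem_nhdsWithin).exists
  obtain ⟨a, ⟨ha1, ha2⟩, ha3⟩ := ((h2.and h2').and self_mem_nhdsWithin).exists
  replace hb3 : t < b := hb3
  replace ha3 : a < t := ha3
  have hsub : ∀ s ∈ Icc a b, dist s t < κ := fun s hs => by
    rw [Real.dist_eq, abs_lt]; constructor <;> linarith [hs.1, hs.2]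
  have hiv := intermediate_value_Icc (ha3.le.trans hb3.le)
    (fun s hs => (hκA (hsub s hs)).1.continuousWithinAt : ContinuousOn w (Icc a b))
  filter_upwards [Icc_mem_nhds ha1 hb1] with y hy
  obtain ⟨s, hs, rfl⟩ := hiv hy
  exact (hκA (hsub s hs)).2

theorem nhds_le_map_of_hasDerivAt {w : ℝ → ℝ} {t w' : ℝ} (hw : ∀ᶠ s in 𝓝 t, ContinuousAt w s)
    (h : HasDerivAt w w' t) (hw' : w' ≠ 0) : 𝓝 (w t) ≤ map w (𝓝 t) := by
  rcases hw'.lt_or_gt with hneg | hpos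
  · have := nhds_le_map_of_hasDerivAt_pos (w := fun s => -w s) (hw.mono fun s hs => hs.neg) h.neg
      (by linarith)
    have h2 := Filter.map_mono (m := fun y : ℝ => -y) this
    rw [Filter.map_map] at h2
    have h3 : map (fun y : ℝ => -y) (𝓝 (-w t)) = 𝓝 (w t) := by
      have := (Homeomorph.neg ℝ).map_nhds_eq (-w t)
      simpa using this
    rw [h3] at h2
    simpa [Function.comp_def] using h2
  · exact nhds_le_map_of_hasDerivAt_pos hw h hpos

end

/-! ### Unit-speed arcs. -/

section
variable {n : ℕ} {M : Type*} [TopologicalSpace M]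

/-- `γ` is, on the set of parameters `I`, a continuous curve of `M` whose image by `u` has
continuous velocity `v` of unit norm. -/
structure IsArc (u : M → Euc n) (γ : ℝ → M) (v : ℝ → Euc n) (I : Set ℝ) : Prop where
  continuousOn : ContinuousOn γ I
  continuousOn_vel : ContinuousOn v I
  hasDerivAt : ∀ t ∈ I, HasDerivAt (fun s => u (γ s)) (v t) t
  norm_vel : ∀ t ∈ I, ‖v t‖ = 1

namespace IsArc
variable {u : M → Euc n} {γ : ℝ → M} {v : ℝ → Euc n} {I : Set ℝ}

theorem mono (h : IsArc u γ v I) {J : Set ℝ} (hJ : J ⊆ I) : IsArc u γ v J :=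
  ⟨h.continuousOn.mono hJ, h.continuousOn_vel.mono hJ, fun t ht => h.hasDerivAt t (hJ ht),
    fun t ht => h.norm_vel t (hJ ht)⟩

theorem congr (h : IsArc u γ v I) (hI : IsOpen I) {γ' : ℝ → M} {v' : ℝ → Euc n}
    (hγ : EqOn γ' γ I) (hv : EqOn v' v I) : IsArc u γ' v' I :=
  ⟨h.continuousOn.congr hγ, h.continuousOn_vel.congr hv, fun t ht => by
    rw [hv ht]
    refine (h.hasDerivAt t ht).congr_of_eventuallyEq ?_
    filter_upwards [hI.mem_nhds ht] with s hs
    rw [hγ hs], fun t ht => by rw [hv ht, h.norm_vel t ht]⟩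

theorem comp_affine (h : IsArc u γ v I) (c σ : ℝ) (hσ : |σ| = 1) :
    IsArc u (fun t => γ (c + σ * t)) (fun t => σ • v (c + σ * t)) ((fun t => c + σ * t) ⁻¹' I) where
  continuousOn := h.continuousOn.comp (by fun_prop) (mapsTo_preimage _ _)
  continuousOn_vel := (h.continuousOn_vel.comp (f := fun t => c + σ * t) (by fun_prop)
    (mapsTo_preimage _ _)).const_smul σ
  hasDerivAt t ht := by
    have h1 : HasDerivAt (fun t : ℝ => c + σ * t) σ t := by
      simpa using ((hasDerivAt_id t).const_mul σ).const_add c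
    exact (h.hasDerivAt _ ht).scomp t h1
  norm_vel t ht := by rw [norm_smul, h.norm_vel _ ht, Real.norm_eq_abs, hσ, one_mul]

theorem comp_affine_univ (h : IsArc u γ v univ) (c σ : ℝ) (hσ : |σ| = 1) :
    IsArc u (fun t => γ (c + σ * t)) (fun t => σ • v (c + σ * t)) univ := by
  simpa using h.comp_affine c σ hσ

theorem continuousAt (h : IsArc u γ v I) (hI : IsOpen I) {t : ℝ} (ht : t ∈ I) :
    ContinuousAt γ t := h.continuousOn.continuousAt (hI.mem_nhds ht)

theorem continuous (h : IsArc u γ v univ) : Continuous γ :=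
  continuousOn_univ.1 h.continuousOn

variable [ChartedSpace ℝ M] [IsManifold 𝓘(ℝ, ℝ) 2 M]

theorem exists_hasDerivAt_chart (hu : IsC2Immersion u) (h : IsArc u γ v I) (hI : IsOpen I)
    {t : ℝ} (ht : t ∈ I) {x : M} (hx : γ t ∈ (chart x).source)
    (hF : deriv (chartRep u x) (chart x (γ t)) ≠ 0) :
    ∃ w', HasDerivAt (fun s => chart x (γ s)) w' t ∧
      v t = w' • deriv (chartRep u x) (chart x (γ t)) := by
  have hc : ContDiffAt ℝ 2 (chartRep u x) (chart x (γ t)) :=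
    hu.contDiffAt_chartRep ((chart x).map_source hx)
  have hs : HasStrictDerivAt (chartRep u x) (deriv (chartRep u x) (chart x (γ t)))
      (chart x (γ t)) := hc.hasStrictDerivAt (by norm_num)
  have hcont := h.continuousAt hI ht
  refine exists_hasDerivAt_of_comp (w := fun s => chart x (γ s)) hs hF
    ((continuousAt_extChartAt' hx).comp hcont) ?_
  refine (h.hasDerivAt t ht).congr_of_eventuallyEq ?_
  filter_upwards [hcont ((isOpen_extChartAt_source x).mem_nhds hx)] with s hs
  simp only [Function.comp, chartRep]
  rw [(chart x).left_inv hs]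

theorem exists_hasDerivAt_chart_self (hu : IsC2Immersion u) (h : IsArc u γ v I) (hI : IsOpen I)
    {t : ℝ} (ht : t ∈ I) :
    ∃ w', HasDerivAt (fun s => chart (γ t) (γ s)) w' t ∧
      v t = w' • deriv (chartRep u (γ t)) (chart (γ t) (γ t)) :=
  h.exists_hasDerivAt_chart hu hI ht (mem_extChartAt_source _) (hu.deriv_chartRep_ne_zero _)

theorem tangentLine_eq (hu : IsC2Immersion u) (h : IsArc u γ v I) (hI : IsOpen I)
    {t : ℝ} (ht : t ∈ I) : tangentLine u (γ t) = Submodule.span ℝ {v t} := by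
  obtain ⟨w', -, hw⟩ := h.exists_hasDerivAt_chart_self hu hI ht
  have : w' ≠ 0 := by
    rintro rfl
    have := h.norm_vel t ht
    rw [hw] at this
    simp at this
  rw [hu.tangentLine_eq, hw, Submodule.span_singleton_smul_eq (IsUnit.mk0 _ this)]

theorem vel_eq_or_eq_neg (hu : IsC2Immersion u) (h : IsArc u γ v I) (hI : IsOpen I)
    {t : ℝ} (ht : t ∈ I) {γ' : ℝ → M} {v' : ℝ → Euc n} {J : Set ℝ} (h' : IsArc u γ' v' J)
    (hJ : IsOpen J) {s : ℝ} (hs : s ∈ J) (hts : γ' s = γ t) : v' s = v t ∨ v' s = - v t := by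
  have h1 : v' s ∈ Submodule.span ℝ {v t} := by
    rw [← h.tangentLine_eq hu hI ht, ← hts, h'.tangentLine_eq hu hJ hs]
    exact Submodule.mem_span_singleton_self _
  obtain ⟨c, hc⟩ := Submodule.mem_span_singleton.1 h1
  have h2 := h'.norm_vel s hs
  rw [← hc, norm_smul, h.norm_vel t ht, mul_one, Real.norm_eq_abs] at h2
  rcases eq_or_eq_neg_of_abs_eq h2 with rfl | rfl
  · left; rw [← hc, one_smul]
  · right; rw [← hc, neg_one_smul]

/-- Arcs are open maps because `M` has dimension one: the chart coordinate has nonzero derivative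
along an arc. -/
theorem nhds_le_map (hu : IsC2Immersion u) (h : IsArc u γ v I) (hI : IsOpen I)
    {t : ℝ} (ht : t ∈ I) : 𝓝 (γ t) ≤ map γ (𝓝 t) := by
  obtain ⟨w', hw, hvw⟩ := h.exists_hasDerivAt_chart_self hu hI ht
  have hw0 : w' ≠ 0 := by
    rintro rfl
    have := h.norm_vel t ht
    rw [hvw] at this
    simp at this
  have hsrc : ∀ᶠ s in 𝓝 t, γ s ∈ (chart (γ t)).source :=
    h.continuousAt hI ht ((isOpen_extChartAt_source (γ t)).mem_nhds (mem_extChartAt_source _))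
  have h1 : 𝓝 (chart (γ t) (γ t)) ≤ map (fun s => chart (γ t) (γ s)) (𝓝 t) := by
    refine nhds_le_map_of_hasDerivAt ?_ hw hw0
    filter_upwards [hsrc, hI.mem_nhds ht] with s hs hsI
    exact (continuousAt_extChartAt' hs).comp (h.continuousAt hI hsI)
  have h2 := Filter.map_mono (m := (chart (γ t)).symm) h1
  have h3 : map (chart (γ t)).symm (𝓝 (chart (γ t) (γ t))) = 𝓝 (γ t) := by
    have := map_extChartAt_symm_nhdsWithin_range (I := 𝓘(ℝ, ℝ)) (γ t)
    simpa using this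
  rw [h3, Filter.map_map] at h2
  refine h2.trans (Filter.map_congr ?_).le
  filter_upwards [hsrc] with s hs
  exact (chart (γ t)).left_inv hs

theorem isOpen_image (hu : IsC2Immersion u) (h : IsArc u γ v I) (hI : IsOpen I)
    {J : Set ℝ} (hJ : IsOpen J) (hJI : J ⊆ I) : IsOpen (γ '' J) := by
  rw [isOpen_iff_mem_nhds]
  rintro _ ⟨t, ht, rfl⟩
  exact h.nhds_le_map hu hI (hJI ht) (image_mem_map (hJ.mem_nhds ht))

end IsArc

variable [ChartedSpace ℝ M] [IsManifold 𝓘(ℝ, ℝ) 2 M]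

theorem IsC2Immersion.continuousOn_deriv_chartRep {u : M → Euc n} (hu : IsC2Immersion u) (x : M) :
    ContinuousOn (deriv (chartRep u x)) (chart x).target :=
  (hu.contDiffOn_chartRep x).continuousOn_deriv_of_isOpen (isOpen_chart_target x) (by norm_num)

theorem IsC2Immersion.exists_ball_chart {u : M → Euc n} (hu : IsC2Immersion u) (x : M) :
    ∃ η > 0, ∃ C > 0, Metric.ball (chart x x) η ⊆ (chart x).target ∧
      ∀ w ∈ Metric.ball (chart x x) η,
        deriv (chartRep u x) w ≠ 0 ∧ ‖deriv (chartRep u x) w‖ < C := by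
  have hx : chart x x ∈ (chart x).target := mem_extChartAt_target x
  have hn := (isOpen_chart_target x).mem_nhds hx
  have hc := (hu.continuousOn_deriv_chartRep x).continuousAt hn
  have h1 := hc.eventually_ne (hu.deriv_chartRep_ne_zero x)
  have h2 := hc.norm.eventually (gt_mem_nhds (lt_add_one _))
  obtain ⟨η, hη, hsub⟩ := Metric.eventually_nhds_iff_ball.1 ((h1.and h2).and hn)
  exact ⟨η, hη, _, by positivity, fun w hw => (hsub w hw).2, fun w hw => (hsub w hw).1⟩

/-- A point has a neighbourhood which is covered, in arbitrarily short time, by all the arcs that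
meet it. -/
theorem IsC2Immersion.exists_nhds_subset_image [T2Space M] {u : M → Euc n} (hu : IsC2Immersion u)
    (x : M) {ε : ℝ} (hε : 0 < ε) :
    ∃ W : Set M, IsOpen W ∧ x ∈ W ∧ ∀ (γ : ℝ → M) (v : ℝ → Euc n) (I : Set ℝ) (t : ℝ),
      IsOpen I → IsArc u γ v I → Icc (t - ε) (t + ε) ⊆ I → γ t ∈ W →
      W ⊆ γ '' Ioo (t - ε) (t + ε) := by
  obtain ⟨η₀, hη₀, C, hC, htgt, hF⟩ := hu.exists_ball_chart x
  set a := chart x x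
  -- In the chart an arc moves at speed at least `1/C`, so in time `ε/2` it covers more than the
  -- width `2η ≤ ε/(4C)` of the ball and must leave `W`.
  set η := min η₀ (ε / (8 * C))
  have hη : 0 < η := by positivity
  have hball : Metric.ball a η ⊆ Metric.ball a η₀ := Metric.ball_subset_ball (min_le_left _ _)
  have hηε : η ≤ ε / (8 * C) := min_le_right _ _
  set W := (chart x).source ∩ chart x ⁻¹' Metric.ball a η
  have hWo : IsOpen W := isOpen_extChartAt_preimage' x Metric.isOpen_ball
  have hWc : IsPreconnected W := by
    have : (chart x).symm '' Metric.ball a η = W :=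
      (chart x).symm_image_eq_source_inter_preimage (hball.trans htgt)
    rw [← this]
    refine ((convex_ball a η).isPreconnected).image _ ?_
    exact (continuousOn_extChartAt_symm x).mono (hball.trans htgt)
  refine ⟨W, hWo, ⟨mem_extChartAt_source x, Metric.mem_ball_self hη⟩, ?_⟩
  intro γ v I t hI h hsub htW
  have exit : ∀ s₀ s₁, s₁ - s₀ = ε / 2 → Icc s₀ s₁ ⊆ I → ∃ s ∈ Icc s₀ s₁, γ s ∉ W := by
    intro s₀ s₁ hs hsI
    by_contra! hcon
    have hlt : s₀ < s₁ := by linarith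
    choose! w' hw' hv using fun s (hs : s ∈ Icc s₀ s₁) =>
      h.exists_hasDerivAt_chart hu hI (hsI hs) (hcon s hs).1 (hF _ (hball (hcon s hs).2)).1
    obtain ⟨ξ, hξ, hslope⟩ := exists_hasDerivAt_eq_slope (fun s => chart x (γ s)) w' hlt
      (fun s hs => (hw' s hs).continuousAt.continuousWithinAt)
      (fun s hs => hw' s (Ioo_subset_Icc_self hs))
    have hξ' := Ioo_subset_Icc_self hξ
    have h1 := h.norm_vel ξ (hsI hξ')
    rw [hv ξ hξ', norm_smul, Real.norm_eq_abs] at h1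
    have h2 := (hF _ (hball (hcon ξ hξ').2)).2
    have h3 : |w' ξ| * (ε / 2) < 2 * η := by
      rw [hslope, hs, abs_div, abs_of_pos (half_pos hε), div_mul_cancel₀ _ (half_pos hε).ne']
      have e0 := (hcon s₀ (left_mem_Icc.2 hlt.le)).2
      have e1 := (hcon s₁ (right_mem_Icc.2 hlt.le)).2
      simp only [mem_preimage, Metric.mem_ball, Real.dist_eq] at e0 e1
      rw [abs_lt] at e0 e1 ⊢
      constructor <;> linarith
    have h4 : 1 ≤ |w' ξ| * C := by
      rw [← h1]; gcongr
    have h5 : η * (8 * C) ≤ ε := by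
      rwa [le_div_iff₀ (by positivity)] at hηε
    nlinarith [abs_nonneg (w' ξ)]
  obtain ⟨t₁, ht₁, ht₁W⟩ := exit t (t + ε / 2) (by ring)
    ((Icc_subset_Icc (by linarith) (by linarith)).trans hsub)
  obtain ⟨t₀, ht₀, ht₀W⟩ := exit (t - ε / 2) t (by ring)
    ((Icc_subset_Icc (by linarith) (by linarith)).trans hsub)
  have ht₁' : t < t₁ := lt_of_le_of_ne ht₁.1 (by rintro rfl; exact ht₁W htW)
  have ht₀' : t₀ < t := lt_of_le_of_ne ht₀.2 (by rintro rfl; exact ht₀W htW)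
  have hIcc : Icc t₀ t₁ ⊆ I :=
    (Icc_subset_Icc (by linarith [ht₀.1]) (by linarith [ht₁.2])).trans hsub
  -- The image of `Ioo t₀ t₁` is open, and closed relative to `W` because the endpoints lie outside
  -- `W`; the connected set `W` is contained in it.
  have hsub' : W ⊆ γ '' Ioo t₀ t₁ := by
    refine hWc.subset_of_closure_inter_subset
      (h.isOpen_image hu hI isOpen_Ioo (Ioo_subset_Icc_self.trans hIcc))
      ⟨γ t, htW, mem_image_of_mem γ ⟨ht₀', ht₁'⟩⟩ ?_
    rintro y ⟨hy, hyW⟩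
    have hcl : IsClosed (γ '' Icc t₀ t₁) :=
      (isCompact_Icc.image_of_continuousOn (h.continuousOn.mono hIcc)).isClosed
    obtain ⟨s, hs, rfl⟩ := closure_minimal (image_mono Ioo_subset_Icc_self) hcl hy
    refine mem_image_of_mem γ ⟨lt_of_le_of_ne hs.1 ?_, lt_of_le_of_ne hs.2 ?_⟩
    · rintro rfl; exact ht₀W hyW
    · rintro rfl; exact ht₁W hyW
  exact hsub'.trans (image_mono (Ioo_subset_Ioo (by linarith [ht₀.1]) (by linarith [ht₁.2])))

end

/-! ### Gluing and extending arcs to the whole line. -/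

section
variable {n : ℕ} {M : Type*} [TopologicalSpace M] {u : M → Euc n}

theorem IsArc.glue {γ γ' : ℝ → M} {v v' : ℝ → Euc n} {a b c d t : ℝ}
    (h : IsArc u γ v (Ioo a b)) (h' : IsArc u γ' v' (Ioo c d)) (ht : t ∈ Ioo a b)
    (ht' : t ∈ Ioo c d) (hγ : γ t = γ' t) (hv : v t = v' t) :
    IsArc u (fun s => if s ≤ t then γ s else γ' s) (fun s => if s ≤ t then v s else v' s)
      (Ioo a d) := by
  have hl : ∀ s ∈ Ioo a d, s ≤ t → s ∈ Ioo a b := fun s hs hst => ⟨hs.1, hst.trans_lt ht.2⟩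
  have hr : ∀ s ∈ Ioo a d, t ≤ s → s ∈ Ioo c d := fun s hs hst => ⟨ht'.1.trans_le hst, hs.2⟩
  have hcl : closure {s : ℝ | s ≤ t} = Iic t := isClosed_Iic.closure_eq
  have hcr : closure {s : ℝ | ¬ s ≤ t} = Ici t := by
    simp only [not_le]; exact closure_Ioi t
  have hfr : frontier {s : ℝ | s ≤ t} = {t} := frontier_Iic
  refine ⟨?_, ?_, ?_, ?_⟩
  · refine ContinuousOn.if ?_ ?_ ?_
    · rintro s ⟨-, hs⟩; rw [hfr] at hs; obtain rfl := hs; exact hγ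
    · rw [hcl]; exact h.continuousOn.mono fun s hs => hl s hs.1 hs.2
    · rw [hcr]; exact h'.continuousOn.mono fun s hs => hr s hs.1 hs.2
  · refine ContinuousOn.if ?_ ?_ ?_
    · rintro s ⟨-, hs⟩; rw [hfr] at hs; obtain rfl := hs; exact hv
    · rw [hcl]; exact h.continuousOn_vel.mono fun s hs => hl s hs.1 hs.2
    · rw [hcr]; exact h'.continuousOn_vel.mono fun s hs => hr s hs.1 hs.2
  · intro s hs
    rcases lt_trichotomy s t with hst | rfl | hst
    · rw [if_pos hst.le]
      refine (h.hasDerivAt s (hl s hs hst.le)).congr_of_eventuallyEq ?_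
      filter_upwards [Iio_mem_nhds hst] with r hr
      rw [if_pos (le_of_lt hr)]
    · rw [if_pos le_rfl]
      have h1 : HasDerivWithinAt (fun r => u (if r ≤ s then γ r else γ' r)) (v s) (Iic s) s := by
        refine (h.hasDerivAt s ht).hasDerivWithinAt.congr (fun r hr => ?_) ?_
        · rw [if_pos (show r ≤ s from hr)]
        · rw [if_pos le_rfl]
      have h2 : HasDerivWithinAt (fun r => u (if r ≤ s then γ r else γ' r)) (v s) (Ici s) s := by
        rw [hv]
        refine (h'.hasDerivAt s ht').hasDerivWithinAt.congr (fun r hr => ?_) ?_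
        · rcases (show s ≤ r from hr).eq_or_lt with rfl | hlt
          · rw [if_pos le_rfl, hγ]
          · rw [if_neg (not_le.2 hlt)]
        · rw [if_pos le_rfl, hγ]
      have h3 := h1.union h2
      rwa [Iic_union_Ici, hasDerivWithinAt_univ] at h3
    · rw [if_neg (not_le.2 hst)]
      refine (h'.hasDerivAt s (hr s hs hst.le)).congr_of_eventuallyEq ?_
      filter_upwards [Ioi_mem_nhds hst] with r hr
      rw [if_neg (not_le.2 hr)]
  · intro s hs
    split_ifs with hst
    · exact h.norm_vel s (hl s hs hst)
    · exact h'.norm_vel s (hr s hs (not_le.1 hst).le)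

variable [ChartedSpace ℝ M] [IsManifold 𝓘(ℝ, ℝ) 2 M]

/-- Arc length in the chart solves `α' = ‖F (α)‖⁻¹` with `F` the derivative of `chartRep u x`; the
right side is `C¹` since `u` is `C²`. -/
theorem IsC2Immersion.exists_local_arc (hu : IsC2Immersion u) (x : M) :
    ∃ ε > 0, ∃ γ v, IsArc u γ v (Ioo (-ε) ε) ∧ γ 0 = x := by
  obtain ⟨η, hη, C, -, htgt, hF⟩ := hu.exists_ball_chart x
  set a := chart x x
  set F := deriv (chartRep u x)
  have ha : a ∈ Metric.ball a η := Metric.mem_ball_self hη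
  have hF1 : ContDiffAt ℝ 1 F a := (hu.contDiffAt_chartRep (htgt ha)).derivWithin (by norm_num)
  have hf : ContDiffAt ℝ 1 (fun w => ‖F w‖⁻¹) a :=
    (hF1.norm ℝ (hF a ha).1).inv (norm_ne_zero_iff.2 (hF a ha).1)
  obtain ⟨α, hα0, ε₀, hε₀, hα⟩ :=
    hf.exists_forall_mem_closedBall_exists_eq_forall_mem_Ioo_hasDerivAt₀ 0
  have hαc : ContinuousAt α 0 := (hα 0 (by simpa using hε₀)).continuousAt
  have hball : ∀ᶠ t in 𝓝 (0 : ℝ), α t ∈ Metric.ball a η :=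
    hαc.eventually (by rw [hα0]; exact Metric.ball_mem_nhds a hη)
  obtain ⟨ε₁, hε₁, hball⟩ := Metric.eventually_nhds_iff_ball.1 hball
  set ε := min ε₀ ε₁
  have hε : 0 < ε := lt_min hε₀ hε₁
  have hI : ∀ t ∈ Ioo (-ε) ε, α t ∈ Metric.ball a η ∧ HasDerivAt α ‖F (α t)‖⁻¹ t := by
    intro t ht
    have h1 : ε ≤ ε₀ := min_le_left _ _
    have h2 : ε ≤ ε₁ := min_le_right _ _
    refine ⟨hball t ?_, hα t ?_⟩
    · rw [mem_ball_zero_iff, Real.norm_eq_abs, abs_lt]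
      constructor <;> linarith [ht.1, ht.2]
    · constructor <;> linarith [ht.1, ht.2]
  have hαcont : ContinuousOn α (Ioo (-ε) ε) := fun t ht =>
    (hI t ht).2.continuousAt.continuousWithinAt
  refine ⟨ε, hε, fun t => (chart x).symm (α t), fun t => ‖F (α t)‖⁻¹ • F (α t), ⟨?_, ?_, ?_, ?_⟩, ?_⟩
  · exact (continuousOn_extChartAt_symm x).comp hαcont fun t ht => htgt (hI t ht).1
  · have h1 : ContinuousOn (fun t => F (α t)) (Ioo (-ε) ε) :=
      (hu.continuousOn_deriv_chartRep x).comp hαcont fun t ht => htgt (hI t ht).1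
    exact (h1.norm.inv₀ fun t ht => norm_ne_zero_iff.2 (hF _ (hI t ht).1).1).smul h1
  · intro t ht
    have h1 : HasDerivAt (chartRep u x) (F (α t)) (α t) :=
      ((hu.contDiffAt_chartRep (htgt (hI t ht).1)).differentiableAt (by norm_num)).hasDerivAt
    exact h1.scomp t (hI t ht).2
  · intro t ht
    rw [norm_smul, norm_inv, norm_norm, inv_mul_cancel₀ (norm_ne_zero_iff.2 (hF _ (hI t ht).1).1)]
  · simp only [hα0]
    exact extChartAt_to_inv x

theorem IsC2Immersion.exists_uniform_local_arc [CompactSpace M] [T2Space M]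
    (hu : IsC2Immersion u) :
    ∃ ε > 0, ∀ x, ∃ γ v, IsArc u γ v (Ioo (-ε) ε) ∧ γ 0 = x := by
  suffices h : ∃ ε > 0, ∀ x ∈ (univ : Set M), ∃ γ v, IsArc u γ v (Ioo (-ε) ε) ∧ γ 0 = x by
    simpa using h
  have hmono : ∀ (x : M) (ε ε' : ℝ), ε' ≤ ε → (∃ γ v, IsArc u γ v (Ioo (-ε) ε) ∧ γ 0 = x) →
      ∃ γ v, IsArc u γ v (Ioo (-ε') ε') ∧ γ 0 = x := by
    rintro x ε ε' hε ⟨γ, v, h, hx⟩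
    exact ⟨γ, v, h.mono (Ioo_subset_Ioo (neg_le_neg hε) hε), hx⟩
  refine isCompact_univ.induction_on (p := fun S => ∃ ε > 0, ∀ x ∈ S, ∃ γ v,
    IsArc u γ v (Ioo (-ε) ε) ∧ γ 0 = x) ⟨1, one_pos, by simp⟩ ?_ ?_ ?_
  · rintro s t hst ⟨ε, hε, h⟩
    exact ⟨ε, hε, fun x hx => h x (hst hx)⟩
  · rintro s t ⟨ε, hε, h⟩ ⟨ε', hε', h'⟩
    refine ⟨min ε ε', lt_min hε hε', fun x hx => ?_⟩
    rcases hx with hx | hx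
    · exact hmono x _ _ (min_le_left _ _) (h x hx)
    · exact hmono x _ _ (min_le_right _ _) (h' x hx)
  · intro x _
    obtain ⟨ε, hε, γ, v, h, hx⟩ := hu.exists_local_arc x
    obtain ⟨W, hW, hxW, hcov⟩ := hu.exists_nhds_subset_image x (half_pos hε)
    refine ⟨W, mem_nhdsWithin_of_mem_nhds (hW.mem_nhds hxW), ε / 2, half_pos hε, fun y hy => ?_⟩
    -- The arc of `x` passes through `y` at a time in `(-ε/2, ε/2)`; recentring there leaves
    -- half-length `ε/2`.
    obtain ⟨s, hs, rfl⟩ := hcov γ v _ 0 isOpen_Ioo h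
      (fun s hs => ⟨by linarith [hs.1], by linarith [hs.2]⟩) (by rwa [hx]) hy
    refine ⟨_, _, (h.comp_affine s 1 (by simp)).mono fun t ht => ?_, by simp⟩
    constructor <;> linarith [hs.1, hs.2, ht.1, ht.2]

theorem IsArc.extend_right (hu : IsC2Immersion u) {ε : ℝ} (hε : 0 < ε)
    (hloc : ∀ x, ∃ γ v, IsArc u γ v (Ioo (-ε) ε) ∧ γ 0 = x) {γ : ℝ → M} {v : ℝ → Euc n}
    {a b t : ℝ} (h : IsArc u γ v (Ioo a b)) (ht : t ∈ Ioo a b) :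
    ∃ γ' v', IsArc u γ' v' (Ioo a (t + ε)) ∧ EqOn γ' γ (Iic t) ∧ EqOn v' v (Iic t) := by
  obtain ⟨φ, w, hφ, hφ0⟩ := hloc (γ t)
  -- The local arc restarted at `γ t` may run backwards; `σ` reverses it so that the velocities
  -- match.
  obtain ⟨σ, hσ, hσv⟩ : ∃ σ : ℝ, |σ| = 1 ∧ σ • w 0 = v t := by
    rcases h.vel_eq_or_eq_neg hu isOpen_Ioo ht hφ isOpen_Ioo (s := 0) (by simpa using hε) hφ0
      with h1 | h1
    · exact ⟨1, by simp, by simp [h1]⟩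
    · exact ⟨-1, by simp, by simp [h1]⟩
  have hφ' := (hφ.comp_affine (-σ * t) σ hσ).mono (J := Ioo (t - ε) (t + ε)) (by
    intro s hs
    have : |s - t| < ε := by rw [abs_lt]; constructor <;> linarith [hs.1, hs.2]
    rw [mem_preimage, mem_Ioo, ← abs_lt, show -σ * t + σ * s = σ * (s - t) by ring, abs_mul, hσ,
      one_mul]
    exact this)
  have e0 : -σ * t + σ * t = 0 := by ring
  refine ⟨_, _, h.glue hφ' ht ⟨by linarith, by linarith⟩ ?_ ?_, ?_, ?_⟩
  · simp only [e0, hφ0]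
  · simp only [e0, hσv]
  · intro s hs; exact if_pos hs
  · intro s hs; exact if_pos hs

/-- Extension to the right, time reversal, extension to the right again, and reversal back. -/
theorem IsArc.extend (hu : IsC2Immersion u) {ε : ℝ} (hε : 0 < ε)
    (hloc : ∀ x, ∃ γ v, IsArc u γ v (Ioo (-ε) ε) ∧ γ 0 = x) {γ : ℝ → M} {v : ℝ → Euc n}
    {b t : ℝ} (h : IsArc u γ v (Ioo (-b) b)) (ht : t ∈ Ioo 0 b) :
    ∃ γ' v', IsArc u γ' v' (Ioo (-(t + ε)) (t + ε)) ∧ EqOn γ' γ (Icc (-t) t) ∧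
      EqOn v' v (Icc (-t) t) := by
  obtain ⟨γ₁, v₁, h₁, hγ₁, hv₁⟩ := h.extend_right hu hε hloc (t := t) ⟨by linarith [ht.1, ht.2], ht.2⟩
  have h₁' := (h₁.comp_affine 0 (-1) (by simp)).mono (J := Ioo (-(t + ε)) b) (by
    intro s hs
    constructor <;> linarith [hs.1, hs.2])
  obtain ⟨γ₂, v₂, h₂, hγ₂, hv₂⟩ := h₁'.extend_right hu hε hloc (t := t)
    ⟨by linarith [ht.1, ht.2], ht.2⟩
  refine ⟨_, _, (h₂.comp_affine 0 (-1) (by simp)).mono (J := Ioo (-(t + ε)) (t + ε)) ?_, ?_, ?_⟩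
  · intro s hs
    constructor <;> linarith [hs.1, hs.2]
  · intro s hs
    have h1 : (0 : ℝ) + -1 * s ∈ Iic t := by rw [mem_Iic]; linarith [hs.1]
    simp only [hγ₂ h1]
    rw [← hγ₁ hs.2]
    congr 1; ring
  · intro s hs
    have h1 : (0 : ℝ) + -1 * s ∈ Iic t := by rw [mem_Iic]; linarith [hs.1]
    simp only [hv₂ h1]
    rw [← hv₁ hs.2, smul_smul]
    norm_num

/-- Every point of a compact immersed curve lies on a complete arc. -/
theorem IsC2Immersion.exists_arc [CompactSpace M] [T2Space M] (hu : IsC2Immersion u) (x : M) :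
    ∃ γ v, IsArc u γ v univ ∧ γ 0 = x := by
  obtain ⟨ε, hε, hloc⟩ := hu.exists_uniform_local_arc
  set η := ε / 2
  have hη : 0 < η := half_pos hε
  -- Stage `k` lives on radius `(k + 2) * η` and is kept unchanged on radius `(k + 1) * η`.
  -- Extending from there by `ε = 2 * η` gives radius `(k + 3) * η`, which is stage `k + 1`.
  let S : ℕ → Type _ := fun k => {p : (ℝ → M) × (ℝ → Euc n) //
    IsArc u p.1 p.2 (Ioo (-((k + 2) * η)) ((k + 2) * η))}
  have step : ∀ k (p : S k), ∃ q : S (k + 1), EqOn q.1.1 p.1.1 (Icc (-((k + 1) * η)) ((k + 1) * η)) ∧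
      EqOn q.1.2 p.1.2 (Icc (-((k + 1) * η)) ((k + 1) * η)) := by
    rintro k ⟨p, hp⟩
    obtain ⟨γ', v', h', hγ', hv'⟩ := hp.extend hu hε hloc (t := (k + 1) * η)
      ⟨by positivity, by nlinarith⟩
    refine ⟨⟨(γ', v'), ?_⟩, hγ', hv'⟩
    have : ((k + 1 : ℕ) + 2 : ℝ) * η = (k + 1) * η + ε := by push_cast; ring
    simp only [this]
    exact h'
  choose next hnextγ hnextv using step
  obtain ⟨γ₀, v₀, h₀, hx₀⟩ := hloc x
  let seq : ∀ k, S k := fun k => Nat.rec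
    ⟨(γ₀, v₀), by simpa [η, mul_div_cancel₀] using h₀⟩ (fun k p => next k p) k
  have hseq : ∀ k, seq (k + 1) = next k (seq k) := fun k => rfl
  have hstab : ∀ k m, k ≤ m → EqOn (seq m).1.1 (seq k).1.1 (Icc (-((k + 1) * η)) ((k + 1) * η)) ∧
      EqOn (seq m).1.2 (seq k).1.2 (Icc (-((k + 1) * η)) ((k + 1) * η)) := by
    intro k m hkm
    induction m, hkm using Nat.le_induction with
    | base => exact ⟨fun _ _ => rfl, fun _ _ => rfl⟩
    | succ m hm ih =>
      have hsub : Icc (-((k + 1) * η)) ((k + 1) * η) ⊆ Icc (-((m + 1) * η)) ((m + 1) * η) := by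
        have : ((k : ℝ) + 1) * η ≤ (m + 1) * η := by gcongr
        exact Icc_subset_Icc (neg_le_neg this) this
      rw [hseq]
      exact ⟨((hnextγ m _).mono hsub).trans ih.1, ((hnextv m _).mono hsub).trans ih.2⟩
  -- `N t` is a stage from which the value at `t` no longer changes.
  let N : ℝ → ℕ := fun t => ⌊|t| / η⌋₊
  have hN : ∀ t, t ∈ Icc (-((N t + 1) * η)) ((N t + 1) * η) := fun t => by
    rw [mem_Icc, ← abs_le, ← div_le_iff₀ hη]
    exact (Nat.lt_floor_add_one _).le
  refine ⟨fun t => (seq (N t)).1.1 t, fun t => (seq (N t)).1.2 t, ?_, ?_⟩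
  · have hloc' : ∀ m : ℕ, IsArc u (fun t => (seq (N t)).1.1 t) (fun t => (seq (N t)).1.2 t)
        (Ioo (-((m + 1) * η)) ((m + 1) * η)) := by
      intro m
      have hNm : ∀ t ∈ Ioo (-((m + 1) * η)) ((m + 1) * η), N t ≤ m := by
        intro t ht
        rw [mem_Ioo, ← abs_lt, ← div_lt_iff₀ hη] at ht
        have := (Nat.floor_lt (by positivity)).2 (show |t| / η < (m + 1 : ℕ) by exact_mod_cast ht)
        exact Nat.lt_succ_iff.1 this
      refine ((seq m).2.mono ?_).congr isOpen_Ioo (fun t ht => ?_) (fun t ht => ?_)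
      · have : ((m : ℝ) + 1) * η ≤ (m + 2) * η := by gcongr; norm_num
        exact Ioo_subset_Ioo (neg_le_neg this) this
      · exact ((hstab _ _ (hNm t ht)).1 (hN t)).symm
      · exact ((hstab _ _ (hNm t ht)).2 (hN t)).symm
    have hmem : ∀ t, t ∈ Ioo (-(((N t + 1 : ℕ) + 1) * η)) (((N t + 1 : ℕ) + 1) * η) := fun t => by
      rw [mem_Ioo, ← abs_lt, ← div_lt_iff₀ hη]
      push_cast
      linarith [Nat.lt_floor_add_one (|t| / η)]
    refine ⟨?_, ?_, fun t _ => (hloc' _).hasDerivAt t (hmem t),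
      fun t _ => (hloc' _).norm_vel t (hmem t)⟩
    · exact fun t _ => ((hloc' _).continuousOn.continuousAt
        (isOpen_Ioo.mem_nhds (hmem t))).continuousWithinAt
    · exact fun t _ => ((hloc' _).continuousOn_vel.continuousAt
        (isOpen_Ioo.mem_nhds (hmem t))).continuousWithinAt
  · have h0 : ∀ k, k = 0 → (seq k).1.1 0 = x := by rintro _ rfl; exact hx₀
    exact h0 _ (by simp [N])

end

/-! ### Consequences of the curvature bound along arcs. -/

section
variable {n : ℕ} {M : Type*} [TopologicalSpace M] [ChartedSpace ℝ M] [IsManifold 𝓘(ℝ, ℝ) 2 M]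
  {u : M → Euc n} {γ : ℝ → M} {v : ℝ → Euc n} {ρ : ℝ}

/-- The acceleration of a unit-speed curve is normal, so it is the normal part of the second
derivative in the chart, rescaled to a unit tangent vector: the second fundamental form on that
vector, up to sign. -/
theorem IsArc.exists_hasDerivAt_vel (hu : IsC2Immersion u) (hcurv : CurvatureBoundedBy u ρ)
    (h : IsArc u γ v univ) (t : ℝ) : ∃ A, HasDerivAt v A t ∧ ‖A‖ ≤ ρ := by
  set x := γ t with hx
  set F := deriv (chartRep u x)
  have hsrc : x ∈ (chart x).source := mem_extChartAt_source x
  have hFx : F (chart x x) ≠ 0 := hu.deriv_chartRep_ne_zero x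
  have hF1 : ContDiffAt ℝ 1 F (chart x x) :=
    (hu.contDiffAt_chartRep (mem_extChartAt_target x)).derivWithin (by norm_num)
  have hγc : ContinuousAt γ t := h.continuous.continuousAt
  have hwc : ContinuousAt (fun s => chart x (γ s)) t :=
    (continuousAt_extChartAt x).comp hγc
  have hFc : ContinuousAt (fun s => F (chart x (γ s))) t :=
    ContinuousAt.comp (f := fun s => chart x (γ s)) (g := F) hF1.continuousAt hwc
  have hsrc' : ∀ᶠ s in 𝓝 t, γ s ∈ (chart x).source :=
    hγc ((isOpen_extChartAt_source x).mem_nhds hsrc)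
  obtain ⟨w', hw', hvw⟩ := h.exists_hasDerivAt_chart_self hu isOpen_univ (mem_univ t)
  change v t = w' • F (chart x x) at hvw
  have hwF : |w'| * ‖F (chart x x)‖ = 1 := by
    rw [← h.norm_vel t (mem_univ t), hvw, norm_smul, Real.norm_eq_abs]
  have hFpos : 0 < ‖F (chart x x)‖ := norm_pos_iff.2 hFx
  -- `σ = ±1` compares the orientations of the arc and the chart; by continuity the sign is constant
  -- near `t`, where `v = σ • F / ‖F‖`.
  set σ := w' * ‖F (chart x x)‖
  have hσ : |σ| = 1 := by rw [abs_mul, abs_norm, hwF]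
  have hσσ : σ * σ = 1 := by rw [← abs_mul_abs_self, hσ, one_mul]
  have hsign : ∀ᶠ s in 𝓝 t, 0 < σ * inner ℝ (v s) (F (chart x (γ s))) := by
    have hc : ContinuousAt (fun s => σ * inner ℝ (v s) (F (chart x (γ s)))) t :=
      (continuousAt_const).mul
        (((continuousOn_univ.1 h.continuousOn_vel).continuousAt).inner hFc)
    refine hc.eventually (lt_mem_nhds ?_)
    change 0 < σ * inner ℝ (v t) (F (chart x x))
    rw [hvw, real_inner_smul_left, real_inner_self_eq_norm_sq]
    have : σ * (w' * ‖F (chart x x)‖ ^ 2) = ‖F (chart x x)‖ * (σ * σ) := by ring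
    rw [this, hσσ, mul_one]
    exact hFpos
  have hv : v =ᶠ[𝓝 t] fun s => σ • (‖F (chart x (γ s))‖⁻¹ • F (chart x (γ s))) := by
    filter_upwards [hsrc', hFc.eventually_ne hFx, hsign] with s hs hFs hpos
    obtain ⟨r, -, hr⟩ := h.exists_hasDerivAt_chart hu isOpen_univ (mem_univ s) hs hFs
    change v s = r • F (chart x (γ s)) at hr
    have hFs' : 0 < ‖F (chart x (γ s))‖ := norm_pos_iff.2 hFs
    have h1 : |r| * ‖F (chart x (γ s))‖ = 1 := by
      rw [← h.norm_vel s (mem_univ s), hr, norm_smul, Real.norm_eq_abs]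
    rw [hr, real_inner_smul_left, real_inner_self_eq_norm_sq, ← mul_assoc] at hpos
    have h2 : 0 < σ * r := (mul_pos_iff_of_pos_right (by positivity)).1 hpos
    have h3 : σ * r = |r| := by rw [← abs_of_pos h2, abs_mul, hσ, one_mul]
    have h4 : r = σ * ‖F (chart x (γ s))‖⁻¹ := by
      rw [← eq_inv_of_mul_eq_one_left h1, ← h3, ← mul_assoc, hσσ, one_mul]
    rw [hr, smul_smul, ← h4]
  set D := deriv F (chart x x)
  have hB : HasDerivAt (fun s => F (chart x (γ s))) (w' • D) t := by
    have h1 : HasDerivAt F D (chart x (γ t)) := (hF1.differentiableAt (by norm_num)).hasDerivAt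
    exact h1.scomp t hw'
  have hN : DifferentiableAt ℝ (fun s => ‖F (chart x (γ s))‖⁻¹) t :=
    (hB.differentiableAt.norm ℝ hFx).inv hFpos.ne'
  have hA := ((hN.hasDerivAt.smul hB).const_smul σ).congr_of_eventuallyEq hv
  set N' := deriv (fun s => ‖F (chart x (γ s))‖⁻¹) t
  refine ⟨_, hA, ?_⟩
  set A := σ • (‖F (chart x (γ t))‖⁻¹ • w' • D + N' • F (chart x (γ t))) with hAdef
  have horth : inner ℝ (v t) A = 0 := by
    have h1 : HasDerivAt (fun s => inner ℝ (v s) (v s)) _ t := hA.inner ℝ hA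
    have h2 : (fun s => inner ℝ (v s) (v s)) = fun _ => (1 : ℝ) := by
      ext s; rw [real_inner_self_eq_norm_sq, h.norm_vel s (mem_univ s), one_pow]
    rw [h2] at h1
    have h3 := h1.unique (hasDerivAt_const t (1 : ℝ))
    have h4 : inner ℝ (v t) A + inner ℝ A (v t) = 0 := h3
    rw [real_inner_comm (v t) A] at h4
    linarith
  have hAmem : A ∈ (tangentLine u x)ᗮ := by
    rw [h.tangentLine_eq hu isOpen_univ (mem_univ t)]
    exact Submodule.mem_orthogonal_singleton_iff_inner_right.2 horth
  have hFmem : F (chart x x) ∈ tangentLine u x := by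
    rw [hu.tangentLine_eq]; exact Submodule.mem_span_singleton_self _
  have hPF : (tangentLine u x)ᗮ.starProjection (F (chart x x)) = 0 :=
    (Submodule.starProjection_apply_eq_zero_iff _).2
      ((Submodule.le_orthogonal_orthogonal _) hFmem)
  -- Projecting to the normal space removes the term in `N'`, which is tangent.
  have hPA : A = (σ * ‖F (chart x x)‖⁻¹ * w') •
      (tangentLine u x)ᗮ.starProjection D := by
    conv_lhs => rw [← Submodule.starProjection_eq_self_iff.2 hAmem, hAdef]
    simp only [map_smul, map_add]
    rw [← hx, hPF, smul_zero, add_zero, smul_smul, smul_smul, mul_assoc]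
  have hsff := hcurv x 1 1
  rw [hu.secondFundamentalForm_eq, hu.diff_eq, one_smul] at hsff
  have hw'' : |w'| = ‖F (chart x x)‖⁻¹ := eq_inv_of_mul_eq_one_left hwF
  rw [hPA, norm_smul, Real.norm_eq_abs, abs_mul, abs_mul, hσ, hw'', abs_inv, abs_norm, one_mul]
  calc ‖F (chart x x)‖⁻¹ * ‖F (chart x x)‖⁻¹ * ‖(tangentLine u x)ᗮ.starProjection D‖
      ≤ ‖F (chart x x)‖⁻¹ * ‖F (chart x x)‖⁻¹ * (ρ * ‖F (chart x x)‖ * ‖F (chart x x)‖) := by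
        gcongr
    _ = ρ := by field_simp

theorem IsArc.norm_vel_sub_le (hu : IsC2Immersion u) (hcurv : CurvatureBoundedBy u ρ)
    (h : IsArc u γ v univ) (s t : ℝ) : ‖v s - v t‖ ≤ ρ * |s - t| := by
  choose A hA hAρ using h.exists_hasDerivAt_vel hu hcurv
  exact convex_univ.norm_image_sub_le_of_norm_hasDerivWithin_le
    (fun t _ => (hA t).hasDerivWithinAt) (fun t _ => hAρ t) (mem_univ t) (mem_univ s)

theorem IsArc.norm_taylor_le_of_nonneg (hu : IsC2Immersion u) (hcurv : CurvatureBoundedBy u ρ)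
    (h : IsArc u γ v univ) {s : ℝ} (hs : 0 ≤ s) :
    ‖u (γ s) - u (γ 0) - s • v 0‖ ≤ ρ / 2 * s ^ 2 := by
  have hd : ∀ r, HasDerivAt (fun r => u (γ r) - u (γ 0) - r • v 0) (v r - v 0) r := fun r => by
    exact (((h.hasDerivAt r (mem_univ r)).sub_const (u (γ 0))).sub
      ((hasDerivAt_id r).smul_const (v 0))).congr_deriv (by rw [one_smul])
  refine image_norm_le_of_norm_deriv_right_le_deriv_boundary
    (f := fun r => u (γ r) - u (γ 0) - r • v 0) (f' := fun r => v r - v 0)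
    (B := fun r => ρ / 2 * r ^ 2) (B' := fun r => ρ * r) (a := 0) (b := s)
    (fun r _ => (hd r).continuousAt.continuousWithinAt) (fun r _ => (hd r).hasDerivWithinAt)
    (by simp) (fun r => ?_) (fun r hr => ?_) (right_mem_Icc.2 hs)
  · have := ((hasDerivAt_id r).pow 2).const_mul (ρ / 2)
    convert! this using 1
    simp; ring
  · have := h.norm_vel_sub_le hu hcurv r 0
    rwa [sub_zero, abs_of_nonneg hr.1] at this

theorem IsArc.norm_taylor_le (hu : IsC2Immersion u) (hcurv : CurvatureBoundedBy u ρ)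
    (h : IsArc u γ v univ) (s t : ℝ) :
    ‖u (γ s) - u (γ t) - (s - t) • v t‖ ≤ ρ / 2 * (s - t) ^ 2 := by
  rcases le_total t s with hst | hst
  · have := (h.comp_affine_univ t 1 (by simp)).norm_taylor_le_of_nonneg hu hcurv
      (sub_nonneg.2 hst)
    simpa using this
  · have := (h.comp_affine_univ t (-1) (by simp)).norm_taylor_le_of_nonneg hu hcurv
      (sub_nonneg.2 hst)
    have e : t + -1 * (t - s) = s := by ring
    rw [e] at this
    simp only [mul_zero, add_zero, smul_smul] at this
    rwa [show (t - s) * -1 = s - t by ring, show (t - s) ^ 2 = (s - t) ^ 2 by ring] at this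

theorem IsArc.abs_sub_le (hu : IsC2Immersion u) (hcurv : CurvatureBoundedBy u ρ)
    (h : IsArc u γ v univ) (s t : ℝ) :
    |s - t| - ρ / 2 * (s - t) ^ 2 ≤ ‖u (γ s) - u (γ t)‖ := by
  have h1 := h.norm_taylor_le hu hcurv s t
  have h2 : ‖(s - t) • v t‖ = |s - t| := by
    rw [norm_smul, h.norm_vel t (mem_univ t), Real.norm_eq_abs, mul_one]
  have h3 := norm_sub_norm_le ((s - t) • v t) (u (γ s) - u (γ t))
  rw [norm_sub_rev ((s - t) • v t), h2] at h3
  linarith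

/-- Pair the Taylor estimate with `v t`. When `ρ > 0`, distinct such parameters are at least `2/ρ`
apart. -/
theorem IsArc.abs_sub_le_of_orthogonal (hu : IsC2Immersion u) (hcurv : CurvatureBoundedBy u ρ)
    (h : IsArc u γ v univ) {s t : ℝ} (hst : u (γ s) - u (γ t) ∈ (tangentLine u (γ t))ᗮ) :
    |s - t| ≤ ρ / 2 * (s - t) ^ 2 := by
  rw [h.tangentLine_eq hu isOpen_univ (mem_univ t),
    Submodule.mem_orthogonal_singleton_iff_inner_right] at hst
  have h1 := h.norm_taylor_le hu hcurv s t
  have h2 := abs_real_inner_le_norm (v t) (u (γ s) - u (γ t) - (s - t) • v t)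
  rw [inner_sub_right, hst, real_inner_smul_right, real_inner_self_eq_norm_sq,
    h.norm_vel t (mem_univ t)] at h2
  simp only [zero_sub, one_pow, mul_one, abs_neg, one_mul] at h2
  exact h2.trans h1

/-- `κ` is at most the sine of the angle between the lines of `a` and `b`, and the distance from `s
• a` to the line of `b` is `|s|` times that sine; likewise with the roles exchanged. -/
theorem max_mul_le_norm_smul_sub_smul {E : Type*} [NormedAddCommGroup E] [InnerProductSpace ℝ E]
    {a b : E} (ha : ‖a‖ = 1) (hb : ‖b‖ = 1) {κ : ℝ} (hκ : κ ^ 2 ≤ 1 - inner ℝ a b ^ 2) (s t : ℝ) :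
    max |s| |t| * κ ≤ ‖s • a - t • b‖ := by
  have hsq : ‖s • a - t • b‖ ^ 2 = s ^ 2 - 2 * (s * t * inner ℝ a b) + t ^ 2 := by
    rw [norm_sub_sq_real, norm_smul, norm_smul, ha, hb, real_inner_smul_left,
      real_inner_smul_right]
    simp; ring
  refine le_of_abs_le (abs_le_of_sq_le_sq ?_ (norm_nonneg _))
  rw [hsq, mul_pow]
  rcases max_choice |s| |t| with h | h <;> rw [h, sq_abs]
  · nlinarith [sq_nonneg (t - s * inner ℝ a b), sq_nonneg s]
  · nlinarith [sq_nonneg (s - t * inner ℝ a b), sq_nonneg t]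

variable {γ' : ℝ → M} {v' : ℝ → Euc n}

theorem norm_error_le {E : Type*} [NormedAddCommGroup E] {A B : E} {s t : ℝ} (hρ : 0 ≤ ρ)
    (hA : ‖A‖ ≤ ρ / 2 * s ^ 2) (hB : ‖B‖ ≤ ρ / 2 * t ^ 2) :
    ‖A - B‖ ≤ ρ * max |s| |t| ^ 2 := by
  have h1 : s ^ 2 ≤ max |s| |t| ^ 2 := by rw [← sq_abs s]; gcongr; exact le_max_left _ _
  have h2 : t ^ 2 ≤ max |s| |t| ^ 2 := by rw [← sq_abs t]; gcongr; exact le_max_right _ _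
  have h3 := norm_sub_le A B
  nlinarith

theorem IsArc.crossing_le (hu : IsC2Immersion u) (hρ : 0 ≤ ρ) (hcurv : CurvatureBoundedBy u ρ)
    (h : IsArc u γ v univ) (h' : IsArc u γ' v' univ) (h0 : u (γ 0) = u (γ' 0)) {κ : ℝ}
    (hκ : κ ^ 2 ≤ 1 - inner ℝ (v 0) (v' 0) ^ 2) (s t : ℝ) :
    max |s| |t| * κ - ρ * max |s| |t| ^ 2 ≤ ‖u (γ s) - u (γ' t)‖ := by
  have h1 := h.norm_taylor_le hu hcurv s 0
  have h2 := h'.norm_taylor_le hu hcurv t 0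
  rw [sub_zero] at h1 h2
  have h3 := norm_error_le hρ h1 h2
  have h4 := max_mul_le_norm_smul_sub_smul (h.norm_vel 0 (mem_univ 0)) (h'.norm_vel 0 (mem_univ 0))
    hκ s t
  have e : u (γ s) - u (γ 0) - s • v 0 - (u (γ' t) - u (γ' 0) - t • v' 0) =
      (u (γ s) - u (γ' t)) - (s • v 0 - t • v' 0) := by rw [h0]; abel
  rw [e] at h3
  have h5 := norm_sub_norm_le (s • v 0 - t • v' 0) (u (γ s) - u (γ' t))
  rw [norm_sub_rev (s • v 0 - t • v' 0)] at h5
  linarith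

/-- Expand both branches from the critical points back to the crossing. The first-order terms are
orthogonal to the difference `D`, so `‖D‖²` is the inner product of `D` with the second-order error.
-/
theorem IsArc.norm_le_of_critical (hu : IsC2Immersion u) (hρ : 0 ≤ ρ)
    (hcurv : CurvatureBoundedBy u ρ)
    (h : IsArc u γ v univ) (h' : IsArc u γ' v' univ) (h0 : u (γ 0) = u (γ' 0)) {s t : ℝ}
    (hs : u (γ s) - u (γ' t) ∈ (tangentLine u (γ s))ᗮ)
    (ht : u (γ s) - u (γ' t) ∈ (tangentLine u (γ' t))ᗮ) :
    ‖u (γ s) - u (γ' t)‖ ≤ ρ * max |s| |t| ^ 2 := by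
  rw [h.tangentLine_eq hu isOpen_univ (mem_univ s),
    Submodule.mem_orthogonal_singleton_iff_inner_right] at hs
  rw [h'.tangentLine_eq hu isOpen_univ (mem_univ t),
    Submodule.mem_orthogonal_singleton_iff_inner_right] at ht
  have h1 := h.norm_taylor_le hu hcurv 0 s
  have h2 := h'.norm_taylor_le hu hcurv 0 t
  rw [zero_sub, neg_sq] at h1 h2
  have h3 := norm_error_le hρ h2 h1
  rw [max_comm] at h3
  set D := u (γ s) - u (γ' t) with hD
  have e : u (γ' 0) - u (γ' t) - -t • v' t - (u (γ 0) - u (γ s) - -s • v s) =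
      D - s • v s + t • v' t := by rw [h0, hD, neg_smul, neg_smul]; abel
  rw [e] at h3
  have h4 : ‖D‖ * ‖D‖ ≤ ‖D‖ * (ρ * max |s| |t| ^ 2) := by
    calc ‖D‖ * ‖D‖ = inner ℝ (D - s • v s + t • v' t) D := by
          rw [inner_add_left, inner_sub_left, real_inner_smul_left, real_inner_smul_left, hs, ht,
            real_inner_self_eq_norm_mul_norm]; ring
      _ ≤ ‖D - s • v s + t • v' t‖ * ‖D‖ := real_inner_le_norm _ _
      _ ≤ _ := by rw [mul_comm]; gcongr
  rcases (norm_nonneg D).eq_or_lt with h5 | h5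
  · rw [← h5]; positivity
  · exact le_of_mul_le_mul_left h4 h5

end

/-! ### Neighbourhoods of self-intersections and of the diagonal. -/

section
variable {n : ℕ} {M : Type*}

/-- The pairs of points of the curves `γ` and `γ'` with parameters in `(-d, d)`. -/
def square (γ γ' : ℝ → M) (d : ℝ) : Set (M × M) := (γ '' Ioo (-d) d) ×ˢ (γ' '' Ioo (-d) d)

/-- The pairs of points of the curves `γ` and `γ'` with parameters in `[-d, d]`. -/
def closedSquare (γ γ' : ℝ → M) (d : ℝ) : Set (M × M) := (γ '' Icc (-d) d) ×ˢ (γ' '' Icc (-d) d)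

theorem mem_square_iff {γ γ' : ℝ → M} {d : ℝ} {p : M × M} :
    p ∈ square γ γ' d ↔ ∃ s t, max |s| |t| < d ∧ p = (γ s, γ' t) := by
  constructor
  · rintro ⟨⟨s, hs, hs'⟩, ⟨t, ht, ht'⟩⟩
    exact ⟨s, t, max_lt (abs_lt.2 hs) (abs_lt.2 ht), Prod.ext hs'.symm ht'.symm⟩
  · rintro ⟨s, t, h, rfl⟩
    exact ⟨mem_image_of_mem _ (abs_lt.1 ((le_max_left _ _).trans_lt h)),
      mem_image_of_mem _ (abs_lt.1 ((le_max_right _ _).trans_lt h))⟩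

theorem mem_closedSquare {γ γ' : ℝ → M} {d s t : ℝ} (h : max |s| |t| ≤ d) :
    (γ s, γ' t) ∈ closedSquare γ γ' d :=
  ⟨mem_image_of_mem _ (abs_le.1 ((le_max_left _ _).trans h)),
    mem_image_of_mem _ (abs_le.1 ((le_max_right _ _).trans h))⟩

theorem closedSquare_subset_square {γ γ' : ℝ → M} {d d' : ℝ} (h : d < d') :
    closedSquare γ γ' d ⊆ square γ γ' d' := by
  have : Icc (-d) d ⊆ Ioo (-d') d' := Icc_subset_Ioo (neg_lt_neg h) h
  exact prod_mono (image_mono this) (image_mono this)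

variable [TopologicalSpace M]

/-- The pairs of points of a common complete arc, at distance less than `d` along it. -/
def tube (u : M → Euc n) (d : ℝ) : Set (M × M) :=
  {p | ∃ γ v s t, IsArc u γ v univ ∧ |s - t| < d ∧ γ s = p.1 ∧ γ t = p.2}

variable {u : M → Euc n} {γ γ' : ℝ → M} {v v' : ℝ → Euc n} {ρ : ℝ}

theorem IsArc.isClosed_closedSquare [T2Space M] (h : IsArc u γ v univ) (h' : IsArc u γ' v' univ)
    (d : ℝ) : IsClosed (closedSquare γ γ' d) :=
  ((isCompact_Icc.image h.continuous).prod (isCompact_Icc.image h'.continuous)).isClosed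

variable [ChartedSpace ℝ M]

theorem tangentAngle_nonneg (x y : M) : 0 ≤ tangentAngle u x y :=
  le_min (InnerProductGeometry.angle_nonneg _ _)
    (sub_nonneg.2 (InnerProductGeometry.angle_le_pi _ _))

theorem tangentAngle_le (x y : M) : tangentAngle u x y ≤ Real.pi / 2 := by
  unfold tangentAngle
  rw [min_le_iff]
  by_contra! h
  linarith [h.1, h.2]

theorem bddBelow_tangentAngle : BddBelow (insert (Real.pi / 2)
    ((fun p : M × M => tangentAngle u p.1 p.2) '' selfIntersectionPairs u)) := by
  refine ⟨0, ?_⟩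
  rintro _ (rfl | ⟨p, -, rfl⟩)
  · positivity
  · exact tangentAngle_nonneg _ _

theorem minAngle_le : minAngle u ≤ Real.pi / 2 :=
  csInf_le bddBelow_tangentAngle (mem_insert _ _)

theorem minAngle_le_tangentAngle {p : M × M} (hp : p ∈ selfIntersectionPairs u) :
    minAngle u ≤ tangentAngle u p.1 p.2 :=
  csInf_le bddBelow_tangentAngle (mem_insert_of_mem _ (mem_image_of_mem _ hp))

theorem IsC2Immersion.continuous (hu : IsC2Immersion u) : Continuous u := hu.1.continuous

variable [IsManifold 𝓘(ℝ, ℝ) 2 M]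

theorem IsArc.isOpen_square (hu : IsC2Immersion u) (h : IsArc u γ v univ)
    (h' : IsArc u γ' v' univ) (d : ℝ) : IsOpen (square γ γ' d) :=
  (h.isOpen_image hu isOpen_univ isOpen_Ioo (subset_univ _)).prod
    (h'.isOpen_image hu isOpen_univ isOpen_Ioo (subset_univ _))

section
variable [T2Space M]

/-- One neighbourhood serves every `d`. This yields both openness of tubes and, by contraposition,
that the closure of a tube lies in any wider one. -/
theorem exists_nhds_subset_tube (hu : IsC2Immersion u) (p : M × M) {ε : ℝ} (hε : 0 < ε) :
    ∃ W ∈ 𝓝 p, ∀ d, (W ∩ tube u d).Nonempty → W ⊆ tube u (d + 2 * ε) := by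
  obtain ⟨W₁, hW₁, hp₁, h₁⟩ := hu.exists_nhds_subset_image p.1 hε
  obtain ⟨W₂, hW₂, hp₂, h₂⟩ := hu.exists_nhds_subset_image p.2 hε
  refine ⟨W₁ ×ˢ W₂, prod_mem_nhds (hW₁.mem_nhds hp₁) (hW₂.mem_nhds hp₂), ?_⟩
  rintro d ⟨q, ⟨hq₁, hq₂⟩, γ, v, s, t, h, hst, hs, ht⟩ p' ⟨hp'₁, hp'₂⟩
  obtain ⟨s', hs', hs''⟩ := h₁ γ v univ s isOpen_univ h (subset_univ _) (hs ▸ hq₁) hp'₁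
  obtain ⟨t', ht', ht''⟩ := h₂ γ v univ t isOpen_univ h (subset_univ _) (ht ▸ hq₂) hp'₂
  refine ⟨γ, v, s', t', h, ?_, hs'', ht''⟩
  rw [abs_lt] at hst ⊢
  constructor <;> linarith [hs'.1, hs'.2, ht'.1, ht'.2]

theorem isOpen_tube (hu : IsC2Immersion u) (d : ℝ) : IsOpen (tube u d) := by
  rw [isOpen_iff_mem_nhds]
  rintro p ⟨γ, v, s, t, h, hst, hs, ht⟩
  obtain ⟨W, hW, hWp⟩ := exists_nhds_subset_tube hu p (ε := (d - |s - t|) / 4) (by linarith)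
  refine mem_of_superset hW ((hWp ((|s - t| + d) / 2)
    ⟨p, mem_of_mem_nhds hW, γ, v, s, t, h, by linarith, hs, ht⟩).trans_eq ?_)
  congr 1; ring

theorem eventually_notMem_tube (hu : IsC2Immersion u) {p : M × M} {d d' : ℝ} (hd : d < d')
    (hp : p ∉ tube u d') : ∀ᶠ q in 𝓝 p, q ∉ tube u d := by
  obtain ⟨W, hW, hWp⟩ := exists_nhds_subset_tube hu p (ε := (d' - d) / 2) (by linarith)
  filter_upwards [hW] with q hq hqd
  have := hWp d ⟨q, hq, hqd⟩ (mem_of_mem_nhds hW)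
  rw [show d + 2 * ((d' - d) / 2) = d' by ring] at this
  exact hp this

theorem mem_tube_self [CompactSpace M] (hu : IsC2Immersion u) {d : ℝ} (hd : 0 < d) (x : M) :
    (x, x) ∈ tube u d := by
  obtain ⟨γ, v, h, hx⟩ := hu.exists_arc x
  exact ⟨γ, v, 0, 0, h, by simpa using hd, hx, hx⟩

end

theorem notMem_tube_of_orthogonal (hu : IsC2Immersion u) (hρ : 0 < ρ)
    (hcurv : CurvatureBoundedBy u ρ) {x y : M} (hxy : x ≠ y)
    (horth : u x - u y ∈ (tangentLine u y)ᗮ) : (x, y) ∉ tube u (1 / ρ) := by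
  rintro ⟨γ, v, s, t, h, hst, rfl, rfl⟩
  have h1 := h.abs_sub_le_of_orthogonal hu hcurv horth
  have h2 : 0 < |s - t| := abs_pos.2 (sub_ne_zero.2 (by rintro rfl; exact hxy rfl))
  rw [lt_div_iff₀ hρ] at hst
  rw [← sq_abs] at h1
  nlinarith

theorem notMem_tube_of_eq (hu : IsC2Immersion u) (hρ : 0 < ρ)
    (hcurv : CurvatureBoundedBy u ρ) {x y : M} (hxy : x ≠ y)
    (heq : u x = u y) : (x, y) ∉ tube u (1 / ρ) :=
  notMem_tube_of_orthogonal hu hρ hcurv hxy (by rw [heq, sub_self]; exact Submodule.zero_mem _)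

/-- With `a = |s - t|`, the lower bound `a - ρ/2 * a²` increases on `[0, 1/ρ]` and equals `3/(8ρ) >
1/(4ρ)` at `a = 1/(2ρ)`. -/
theorem mem_tube_of_norm_lt (hu : IsC2Immersion u) (hρ : 0 < ρ)
    (hcurv : CurvatureBoundedBy u ρ) {p : M × M} (hp : p ∈ tube u (1 / ρ))
    (hlt : ‖u p.1 - u p.2‖ < 1 / (4 * ρ)) : p ∈ tube u (1 / (2 * ρ)) := by
  obtain ⟨γ, v, s, t, h, hst, hs, ht⟩ := hp
  refine ⟨γ, v, s, t, h, ?_, hs, ht⟩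
  rw [← hs, ← ht] at hlt
  have h1 := (h.abs_sub_le hu hcurv s t).trans_lt hlt
  rw [lt_div_iff₀ (by positivity)] at hst h1 ⊢
  rw [← sq_abs] at h1
  nlinarith [abs_nonneg (s - t)]

theorem orthogonal_of_isLocalMin [CompactSpace M] [T2Space M] (hu : IsC2Immersion u) {x : M}
    {c : Euc n} (h : IsLocalMin (fun y => ‖u y - c‖) x) : u x - c ∈ (tangentLine u x)ᗮ := by
  obtain ⟨γ, v, hγ, rfl⟩ := hu.exists_arc x
  rw [hγ.tangentLine_eq hu isOpen_univ (mem_univ 0),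
    Submodule.mem_orthogonal_singleton_iff_inner_right]
  have h1 : IsLocalMin (fun s => ‖u (γ s) - c‖ ^ 2) 0 := by
    filter_upwards [hγ.continuous.continuousAt.eventually h] with s hs
    gcongr
  have h2 := ((hγ.hasDerivAt 0 (mem_univ 0)).sub_const c).norm_sq
  have h3 := h1.hasDerivAt_eq_zero h2
  rw [real_inner_comm]
  linarith

theorem orthogonal_of_isLocalMin_pair [CompactSpace M] [T2Space M] (hu : IsC2Immersion u)
    {z : M × M} (h : IsLocalMin (fun p : M × M => ‖u p.1 - u p.2‖) z) :
    u z.1 - u z.2 ∈ (tangentLine u z.1)ᗮ ∧ u z.1 - u z.2 ∈ (tangentLine u z.2)ᗮ := by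
  constructor
  · apply orthogonal_of_isLocalMin hu
    have : ContinuousAt (fun y => (y, z.2)) z.1 := by fun_prop
    exact this.eventually h
  · rw [← neg_sub, Submodule.neg_mem_iff]
    apply orthogonal_of_isLocalMin hu
    have : ContinuousAt (fun y => (z.1, y)) z.2 := by fun_prop
    filter_upwards [this.eventually h] with y hy
    rw [norm_sub_rev, norm_sub_rev (u y)]
    exact hy

/-! ### Angles at self-intersections. -/

section Angle

theorem IsArc.exists_smul_diff (hu : IsC2Immersion u) (h : IsArc u γ v univ) (t : ℝ) :
    ∃ c : ℝ, c ≠ 0 ∧ diff u (γ t) 1 = c • v t := by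
  have h1 : diff u (γ t) 1 ∈ Submodule.span ℝ {v t} := by
    rw [← h.tangentLine_eq hu isOpen_univ (mem_univ t)]
    exact Submodule.subset_span ⟨1, rfl⟩
  obtain ⟨c, hc⟩ := Submodule.mem_span_singleton.1 h1
  refine ⟨c, ?_, hc.symm⟩
  rintro rfl
  have := hu.deriv_chartRep_ne_zero (γ t)
  rw [hu.diff_eq, one_smul, zero_smul] at hc
  exact this hc.symm

theorem IsArc.sin_tangentAngle_sq (hu : IsC2Immersion u) (h : IsArc u γ v univ)
    (h' : IsArc u γ' v' univ) :
    Real.sin (tangentAngle u (γ 0) (γ' 0)) ^ 2 = 1 - inner ℝ (v 0) (v' 0) ^ 2 := by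
  obtain ⟨c, hc, hcv⟩ := h.exists_smul_diff hu 0
  obtain ⟨d, hd, hdv⟩ := h'.exists_smul_diff hu 0
  have h1 : Real.sin (tangentAngle u (γ 0) (γ' 0)) =
      Real.sin (InnerProductGeometry.angle (diff u (γ 0) 1) (diff u (γ' 0) 1)) := by
    unfold tangentAngle
    rcases min_choice (InnerProductGeometry.angle (diff u (γ 0) 1) (diff u (γ' 0) 1))
      (Real.pi - InnerProductGeometry.angle (diff u (γ 0) 1) (diff u (γ' 0) 1)) with h | h <;>
      rw [h]
    rw [Real.sin_pi_sub]
  rw [h1, Real.sin_sq, InnerProductGeometry.cos_angle, hcv, hdv, norm_smul, norm_smul,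
    h.norm_vel 0 (mem_univ 0), h'.norm_vel 0 (mem_univ 0), real_inner_smul_left,
    real_inner_smul_right, div_pow, mul_one, mul_one, mul_pow, mul_pow, mul_pow, Real.norm_eq_abs,
    Real.norm_eq_abs, sq_abs, sq_abs]
  field_simp

theorem tangentAngle_pos [CompactSpace M] [T2Space M] (hu : IsC2Immersion u)
    (htrans : TransverseSelfIntersections u) {p : M × M} (hp : p ∈ selfIntersectionPairs u) :
    0 < tangentAngle u p.1 p.2 := by
  refine (tangentAngle_nonneg _ _).lt_of_ne' fun h0 => htrans _ _ hp.1 hp.2 ?_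
  obtain ⟨γ, v, h, hx⟩ := hu.exists_arc p.1
  obtain ⟨γ', v', h', hy⟩ := hu.exists_arc p.2
  have h1 := h.sin_tangentAngle_sq hu h'
  rw [hx, hy, h0, Real.sin_zero] at h1
  rw [← hx, ← hy, h.tangentLine_eq hu isOpen_univ (mem_univ 0),
    h'.tangentLine_eq hu isOpen_univ (mem_univ 0)]
  set c := inner ℝ (v 0) (v' 0)
  have hc : c ≠ 0 := by rintro hc; rw [hc] at h1; norm_num at h1
  -- Angle zero gives `c² = 1`, the equality case of Cauchy–Schwarz.
  have h2 : ‖v 0 - c • v' 0‖ ^ 2 = 0 := by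
    rw [norm_sub_sq_real, norm_smul, h.norm_vel 0 (mem_univ 0), h'.norm_vel 0 (mem_univ 0),
      real_inner_smul_right, Real.norm_eq_abs, mul_one, sq_abs]
    change 1 ^ 2 - 2 * (c * c) + c ^ 2 = 0
    linarith
  have h3 : v 0 = c • v' 0 := by
    rw [← sub_eq_zero, ← norm_eq_zero]; exact pow_eq_zero_iff two_ne_zero |>.1 h2
  rw [h3, Submodule.span_singleton_smul_eq (IsUnit.mk0 _ hc)]

theorem minAngle_pos [CompactSpace M] [T2Space M] (hu : IsC2Immersion u)
    (htrans : TransverseSelfIntersections u) (hfin : (selfIntersectionPairs u).Finite) :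
    0 < minAngle u := by
  have := (insert_nonempty (Real.pi / 2) ((fun p : M × M => tangentAngle u p.1 p.2) ''
    selfIntersectionPairs u)).csInf_mem ((hfin.image _).insert _)
  change minAngle u ∈ _ at this
  rcases this with h | ⟨p, hp, h⟩
  · rw [h]; positivity
  · rw [← h]; exact tangentAngle_pos hu htrans hp

end Angle

/-! ### Finiteness of the self-intersections. -/

section Finite
variable [CompactSpace M] [T2Space M]

/-- Replacing the diagonal by an open tube around it exhibits the set as compact. -/
theorem selfIntersectionPairs_eq (hu : IsC2Immersion u) (hρ : 0 < ρ)
    (hcurv : CurvatureBoundedBy u ρ) :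
    selfIntersectionPairs u = {p | u p.1 = u p.2} \ tube u (1 / ρ) := by
  ext ⟨x, y⟩
  constructor
  · rintro ⟨hne, heq⟩
    exact ⟨heq, notMem_tube_of_eq hu hρ hcurv hne heq⟩
  · rintro ⟨heq, hnot⟩
    refine ⟨fun hxy => ?_, heq⟩
    obtain rfl : x = y := hxy
    exact hnot (mem_tube_self hu (by positivity) _)

theorem finite_selfIntersectionPairs (hu : IsC2Immersion u) (hρ : 0 < ρ)
    (hcurv : CurvatureBoundedBy u ρ) (htrans : TransverseSelfIntersections u) :
    (selfIntersectionPairs u).Finite := by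
  have hc : Continuous u := hu.continuous
  have hcomp : IsCompact (selfIntersectionPairs u) := by
    rw [selfIntersectionPairs_eq hu hρ hcurv]
    exact ((isClosed_eq (hc.comp continuous_fst) (hc.comp continuous_snd)).isCompact).diff
      (isOpen_tube hu _)
  suffices h : (selfIntersectionPairs u ∩ selfIntersectionPairs u).Finite by rwa [inter_self] at h
  refine hcomp.induction_on (p := fun S => (S ∩ selfIntersectionPairs u).Finite) (by simp)
    (fun s t hst ht => ht.subset (inter_subset_inter_left _ hst))
    (fun s t hs ht => by rw [union_inter_distrib_right]; exact hs.union ht) ?_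
  intro p hp
  obtain ⟨γ, v, h, hx⟩ := hu.exists_arc p.1
  obtain ⟨γ', v', h', hy⟩ := hu.exists_arc p.2
  have hκ := Real.sin_pos_of_pos_of_lt_pi (tangentAngle_pos hu htrans hp)
    ((tangentAngle_le _ _).trans_lt (by linarith [Real.pi_pos]))
  set κ := Real.sin (tangentAngle u p.1 p.2) with hκdef
  have hκsq : κ ^ 2 = 1 - inner ℝ (v 0) (v' 0) ^ 2 := by
    rw [hκdef, ← hx, ← hy]; exact h.sin_tangentAngle_sq hu h'
  have hpmem : p ∈ square γ γ' (κ / ρ) :=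
    mem_square_iff.2 ⟨0, 0, by simp; positivity, by rw [hx, hy]⟩
  refine ⟨square γ γ' (κ / ρ),
    mem_nhdsWithin_of_mem_nhds ((h.isOpen_square hu h' _).mem_nhds hpmem),
    (finite_singleton p).subset ?_⟩
  rintro q ⟨hq, hq'⟩
  obtain ⟨s, t, hst, rfl⟩ := mem_square_iff.1 hq
  have h1 := h.crossing_le hu hρ.le hcurv h' (by rw [hx, hy]; exact hp.2) hκsq.le s t
  rw [show u (γ s) = u (γ' t) from hq'.2, sub_self, norm_zero] at h1
  rw [lt_div_iff₀ hρ] at hst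
  have h0 : max |s| |t| ≤ 0 := by
    by_contra! hpos
    nlinarith
  have hs : s = 0 := abs_nonpos_iff.1 ((le_max_left _ _).trans h0)
  have ht : t = 0 := abs_nonpos_iff.1 ((le_max_right _ _).trans h0)
  rw [hs, ht, hx, hy]; rfl

/-- The infimum could vanish without being attained. All competitors lie in the compact slice
outside the tube, where the distance attains its minimum. -/
theorem selfIntersectionPoints_eq (hu : IsC2Immersion u) (hρ : 0 < ρ)
    (hcurv : CurvatureBoundedBy u ρ) :
    selfIntersectionPoints u = Prod.fst '' selfIntersectionPairs u := by
  ext x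
  constructor
  · intro hx
    by_contra hcon
    have hne : ∀ y, (x, y) ∉ tube u (1 / ρ) → edist (u x) (u y) ≠ 0 := by
      intro y hy h0
      refine hcon ⟨(x, y), ⟨fun hxy => ?_, edist_eq_zero.1 h0⟩, rfl⟩
      obtain rfl : x = y := hxy
      exact hy (mem_tube_self hu (by positivity) _)
    have hK : IsCompact {y | (x, y) ∉ tube u (1 / ρ)} :=
      ((isOpen_tube hu (1 / ρ)).preimage (by fun_prop : Continuous fun y => (x, y))).isClosed_compl.isCompact
    have hle : ∀ c : ℝ≥0∞, (∀ y, (x, y) ∉ tube u (1 / ρ) → c ≤ edist (u x) (u y)) →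
        c ≤ normalReach u x := fun c hc => le_iInf₂ fun y hy => hc y
      (notMem_tube_of_orthogonal hu hρ hcurv hy.1.symm hy.2)
    change normalReach u x = 0 at hx
    rcases eq_empty_or_nonempty {y | (x, y) ∉ tube u (1 / ρ)} with hemp | hnon
    · have := hle ⊤ fun y hy => absurd (show y ∈ {y | (x, y) ∉ tube u (1 / ρ)} from hy)
        (by rw [hemp]; exact notMem_empty y)
      rw [hx] at this
      exact absurd this (by simp)
    · obtain ⟨y, hy, hmin⟩ := hK.exists_isMinOn hnon
        (f := fun y => edist (u x) (u y)) (continuous_const.edist hu.continuous).continuousOn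
      have := hle _ fun z hz => hmin hz
      rw [hx] at this
      exact hne y hy (le_antisymm this zero_le)
  · rintro ⟨⟨x, y⟩, ⟨hne, heq⟩, rfl⟩
    refine le_antisymm ?_ zero_le
    refine (iInf₂_le y ⟨hne.symm, ?_⟩).trans_eq (edist_eq_zero.2 heq)
    rw [show u x = u y from heq, sub_self]
    exact Submodule.zero_mem _

end Finite

end

/-! ### Measure of short arcs. -/

section
variable {n : ℕ} {M : Type*} {u : M → Euc n} {ρ : ℝ} {α : M → ℝ → M} {ν : M → ℝ → Euc n}

theorem mem_square_self (hα0 : ∀ x, α x 0 = x) {d : ℝ} (hd : 0 < d) (q : M × M) :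
    q ∈ square (α q.1) (α q.2) d :=
  mem_square_iff.2 ⟨0, 0, by simpa using hd, by rw [hα0, hα0]⟩

variable [TopologicalSpace M] [ChartedSpace ℝ M]

theorem HasLipschitzDensity.measure_le [MeasurableSpace M] {μ : Measure M} {L : ℝ≥0} {fmin fmax : ℝ}
    (h : HasLipschitzDensity u μ L fmin fmax) {A : Set M} (hA : MeasurableSet A) :
    μ A ≤ ENNReal.ofReal fmax * pullbackHausdorff u A := by
  obtain ⟨f, hμ, -, hf⟩ := h
  rw [hμ, withDensity_apply _ hA, ← setLIntegral_const]
  exact lintegral_mono fun x => ENNReal.ofReal_le_ofReal (hf x).2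

variable [IsManifold 𝓘(ℝ, ℝ) 2 M] [T2Space M]

theorem IsArc.pullbackHausdorff_image_le [MeasurableSpace M] [BorelSpace M] {γ : ℝ → M}
    {v : ℝ → Euc n} (hu : IsC2Immersion u)
    (hρ : 0 < ρ) (hcurv : CurvatureBoundedBy u ρ) (h : IsArc u γ v univ) {d : ℝ}
    (hd : d < 1 / ρ) :
    pullbackHausdorff u (γ '' Icc (-d) d) ≤ ENNReal.ofReal (2 * d) := by
  have hAc : IsCompact (γ '' Icc (-d) d) := isCompact_Icc.image h.continuous
  set A := γ '' Icc (-d) d with hA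
  -- Parameters differ by at most `2d < 2/ρ`, and equal images at distinct parameters need a gap of
  -- at least `2/ρ`. So fibres over the arc count at most one point.
  have hinj : InjOn u A := by
    rintro _ ⟨s, hs, rfl⟩ _ ⟨t, ht, rfl⟩ heq
    have h1 := h.abs_sub_le hu hcurv s t
    rw [heq, sub_self, norm_zero, ← sq_abs] at h1
    have h2 : |s - t| ≤ 2 * d := by
      rw [abs_le]; constructor <;> linarith [hs.1, hs.2, ht.1, ht.2]
    rw [lt_div_iff₀ hρ] at hd
    have h4 : |s - t| * ρ ≤ 2 * d * ρ := by gcongr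
    have h3 : |s - t| ≤ 0 := by
      by_contra! hpos
      nlinarith
    rw [sub_eq_zero.1 (abs_nonpos_iff.1 h3)]
  have huA : MeasurableSet (u '' A) := (hAc.image hu.continuous).isClosed.measurableSet
  have hcount : ∀ y, (Measure.count.restrict (u ⁻¹' {y})) A ≤ (u '' A).indicator 1 y := by
    intro y
    rw [Measure.restrict_apply hAc.isClosed.measurableSet]
    by_cases hy : y ∈ u '' A
    · obtain ⟨x, hx, rfl⟩ := hy
      have : A ∩ u ⁻¹' {u x} ⊆ {x} := fun z hz => hinj hz.1 hx hz.2
      refine (measure_mono this).trans ?_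
      rw [Measure.count_singleton, indicator_of_mem (mem_image_of_mem u hx), Pi.one_apply]
    · have : A ∩ u ⁻¹' {y} = ∅ := by
        rw [eq_empty_iff_forall_notMem]
        rintro z ⟨hz, hzy⟩
        exact hy ⟨z, hz, hzy⟩
      rw [this, measure_empty]
      exact zero_le
  have hlip : LipschitzOnWith 1 (fun s => u (γ s)) (Icc (-d) d) := by
    refine (LipschitzWith.of_dist_le_mul fun s t => ?_).lipschitzOnWith
    rw [dist_eq_norm, dist_eq_norm, NNReal.coe_one]
    exact convex_univ.norm_image_sub_le_of_norm_hasDerivWithin_le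
      (fun t _ => (h.hasDerivAt t (mem_univ t)).hasDerivWithinAt)
      (fun t _ => (h.norm_vel t (mem_univ t)).le) (mem_univ t) (mem_univ s)
  calc pullbackHausdorff u A
      ≤ ∫⁻ y, (Measure.count.restrict (u ⁻¹' {y})) A ∂(Measure.hausdorffMeasure 1) :=
        Measure.bind_apply_le _ hAc.isClosed.measurableSet
    _ ≤ ∫⁻ y, (u '' A).indicator 1 y ∂(Measure.hausdorffMeasure 1) := lintegral_mono hcount
    _ = Measure.hausdorffMeasure 1 (u '' A) := lintegral_indicator_one huA
    _ = Measure.hausdorffMeasure 1 ((fun s => u (γ s)) '' Icc (-d) d) := by rw [hA, image_image]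
    _ ≤ Measure.hausdorffMeasure 1 (Icc (-d) d) := by
        simpa using hlip.hausdorffMeasure_image_le zero_le_one
    _ = ENNReal.ofReal (2 * d) := by
        rw [hausdorffMeasure_real, Real.volume_Icc]
        congr 1; ring

/-! ### Compactness argument away from the self-intersections. -/

variable [CompactSpace M]

theorem sin_minAngle_pos (hu : IsC2Immersion u) (hρ : 0 < ρ) (hcurv : CurvatureBoundedBy u ρ)
    (htrans : TransverseSelfIntersections u) : 0 < Real.sin (minAngle u) :=
  Real.sin_pos_of_pos_of_lt_pi
    (minAngle_pos hu htrans (finite_selfIntersectionPairs hu hρ hcurv htrans))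
    (minAngle_le.trans_lt (by linarith [Real.pi_pos]))

/-- Lower bound for the distance between the branches at a self-intersection. -/
theorem selfIntersection_crossing_le (hu : IsC2Immersion u) (hρ : 0 < ρ)
    (hcurv : CurvatureBoundedBy u ρ) (htrans : TransverseSelfIntersections u)
    (hα : ∀ x, IsArc u (α x) (ν x) univ) (hα0 : ∀ x, α x 0 = x) {q : M × M}
    (hq : q ∈ selfIntersectionPairs u) (s t : ℝ) :
    max |s| |t| * Real.sin (minAngle u) - ρ * max |s| |t| ^ 2 ≤
      ‖u (α q.1 s) - u (α q.2 t)‖ := by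
  refine (hα q.1).crossing_le hu hρ.le hcurv (hα q.2) (by rw [hα0, hα0]; exact hq.2) ?_ s t
  rw [← (hα q.1).sin_tangentAngle_sq hu (hα q.2), hα0, hα0]
  have h0 := sin_minAngle_pos hu hρ hcurv htrans
  have hΘ := minAngle_pos hu htrans (finite_selfIntersectionPairs hu hρ hcurv htrans)
  gcongr
  exact Real.sin_le_sin_of_le_of_le_pi_div_two (by linarith [Real.pi_pos]) (tangentAngle_le _ _)
    (minAngle_le_tangentAngle hq)

/-- With `m = max |s| |t|` and `σ = sin Θ`, the two estimates give `m σ - ρ m² ≤ ρ m²`, which forces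
`m = 0` when `m < σ/(2ρ)`. -/
theorem eq_of_mem_square_of_critical (hu : IsC2Immersion u) (hρ : 0 < ρ)
    (hcurv : CurvatureBoundedBy u ρ) (htrans : TransverseSelfIntersections u)
    (hα : ∀ x, IsArc u (α x) (ν x) univ) (hα0 : ∀ x, α x 0 = x) {q p : M × M}
    (hq : q ∈ selfIntersectionPairs u)
    (hp : p ∈ square (α q.1) (α q.2) (Real.sin (minAngle u) / (2 * ρ)))
    (hp₁ : u p.1 - u p.2 ∈ (tangentLine u p.1)ᗮ) (hp₂ : u p.1 - u p.2 ∈ (tangentLine u p.2)ᗮ) :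
    p = q := by
  obtain ⟨s, t, hst, rfl⟩ := mem_square_iff.1 hp
  have h1 := selfIntersection_crossing_le hu hρ hcurv htrans hα hα0 hq s t
  have h2 := (hα q.1).norm_le_of_critical hu hρ.le hcurv (hα q.2)
    (by rw [hα0, hα0]; exact hq.2) hp₁ hp₂
  rw [lt_div_iff₀ (by positivity)] at hst
  have h0 : max |s| |t| ≤ 0 := by
    by_contra! hpos
    nlinarith
  have hs : s = 0 := abs_nonpos_iff.1 ((le_max_left _ _).trans h0)
  have ht : t = 0 := abs_nonpos_iff.1 ((le_max_right _ _).trans h0)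
  rw [hs, ht, hα0, hα0]

/-- In the square `ρ m ≤ σ/2`, so the crossing estimate becomes `m σ/2 ≤ r`. -/
theorem mem_closedSquare_of_norm_le (hu : IsC2Immersion u) (hρ : 0 < ρ)
    (hcurv : CurvatureBoundedBy u ρ) (htrans : TransverseSelfIntersections u)
    (hα : ∀ x, IsArc u (α x) (ν x) univ) (hα0 : ∀ x, α x 0 = x) {q p : M × M}
    (hq : q ∈ selfIntersectionPairs u)
    (hp : p ∈ square (α q.1) (α q.2) (Real.sin (minAngle u) / (2 * ρ))) {r : ℝ}
    (hr : ‖u p.1 - u p.2‖ ≤ r) :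
    p ∈ closedSquare (α q.1) (α q.2) (2 * r / Real.sin (minAngle u)) := by
  have hσ := sin_minAngle_pos hu hρ hcurv htrans
  obtain ⟨s, t, hst, rfl⟩ := mem_square_iff.1 hp
  apply mem_closedSquare
  have h1 := (selfIntersection_crossing_le hu hρ hcurv htrans hα hα0 hq s t).trans hr
  have h0 : 0 ≤ max |s| |t| := (abs_nonneg s).trans (le_max_left _ _)
  rw [lt_div_iff₀ (by positivity)] at hst
  rw [le_div_iff₀ hσ]
  nlinarith

/-- The pairs that are neither close along an arc nor close to a self-intersection. -/
def farPairs (u : M → Euc n) (ρ : ℝ) (α : M → ℝ → M) : Set (M × M) :=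
  (tube u (1 / ρ) ∪
    ⋃ q ∈ selfIntersectionPairs u, square (α q.1) (α q.2) (Real.sin (minAngle u) / (2 * ρ)))ᶜ

theorem isCompact_farPairs (hu : IsC2Immersion u) (hα : ∀ x, IsArc u (α x) (ν x) univ) :
    IsCompact (farPairs u ρ α) :=
  ((isOpen_tube hu _).union (isOpen_biUnion fun q _ =>
    (hα q.1).isOpen_square hu (hα q.2) _)).isClosed_compl.isCompact

theorem notMem_selfIntersectionPairs_of_mem_farPairs (hu : IsC2Immersion u) (hρ : 0 < ρ)
    (hcurv : CurvatureBoundedBy u ρ) (htrans : TransverseSelfIntersections u)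
    (hα0 : ∀ x, α x 0 = x) {p : M × M} (hp : p ∈ farPairs u ρ α) :
    p ∉ selfIntersectionPairs u := fun h =>
  hp (Or.inr (mem_biUnion h (mem_square_self hα0
    (div_pos (sin_minAngle_pos hu hρ hcurv htrans) (by positivity)) p)))

theorem ne_of_mem_farPairs (hu : IsC2Immersion u) (hρ : 0 < ρ) {p : M × M}
    (hp : p ∈ farPairs u ρ α) : p.1 ≠ p.2 := by
  obtain ⟨x, y⟩ := p
  rintro (rfl : x = y)
  exact hp (Or.inl (mem_tube_self hu (by positivity) x))

theorem minCriticalDist_pos (hu : IsC2Immersion u) (hρ : 0 < ρ) (hcurv : CurvatureBoundedBy u ρ)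
    (htrans : TransverseSelfIntersections u) : 0 < minCriticalDist u := by
  choose α ν hα hα0 using hu.exists_arc
  have hmem : criticalPairs u \ selfIntersectionPairs u ⊆ farPairs u ρ α := by
    rintro p ⟨hp, hp'⟩ (h | h)
    · exact notMem_tube_of_orthogonal hu hρ hcurv hp.1 hp.2.1 h
    · obtain ⟨q, hq, hpq⟩ := mem_iUnion₂.1 h
      exact hp' (eq_of_mem_square_of_critical hu hρ hcurv htrans hα hα0 hq hpq hp.2.2 hp.2.1 ▸ hq)
  rcases (farPairs u ρ α).eq_empty_or_nonempty with hemp | hnon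
  · rw [hemp, subset_empty_iff] at hmem
    rw [minCriticalDist, hmem]
    simp
  · obtain ⟨p, hp, hmin⟩ := (isCompact_farPairs hu hα).exists_isMinOn hnon
      (f := fun p : M × M => edist (u p.1) (u p.2))
      ((hu.continuous.comp continuous_fst).edist (hu.continuous.comp continuous_snd)).continuousOn
    have hpos : 0 < edist (u p.1) (u p.2) := edist_pos.2 fun heq =>
      notMem_selfIntersectionPairs_of_mem_farPairs hu hρ hcurv htrans hα0 hp
        ⟨ne_of_mem_farPairs hu hρ hp, heq⟩
    exact hpos.trans_le (le_iInf₂ fun q hq => hmin (hmem hq))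

/-- Two points of an immersed curve at small distance are close along an arc, or close to a
self-intersection. -/
theorem exists_mem_closedSquare (hu : IsC2Immersion u) (hρ : 0 < ρ)
    (hcurv : CurvatureBoundedBy u ρ) (htrans : TransverseSelfIntersections u)
    (hα : ∀ x, IsArc u (α x) (ν x) univ) (hα0 : ∀ x, α x 0 = x) {r : ℝ}
    (hrΔ : ENNReal.ofReal r < minCriticalDist u)
    (hr : r < Real.sin (minAngle u) ^ 2 / (4 * ρ)) {p : M × M} (hp : p ∉ tube u (1 / ρ))
    (hpr : ‖u p.1 - u p.2‖ ≤ r) :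
    ∃ q ∈ selfIntersectionPairs u,
      p ∈ closedSquare (α q.1) (α q.2) (2 * r / Real.sin (minAngle u)) := by
  have hσ := sin_minAngle_pos hu hρ hcurv htrans
  set σ := Real.sin (minAngle u)
  have hr' := hr
  rw [lt_div_iff₀ (by positivity)] at hr'
  -- This is where the threshold `σ²/(4ρ)` comes from: the closed squares must fit inside the open
  -- ones.
  have hsmall : 2 * r / σ < σ / (2 * ρ) := by
    rw [div_lt_div_iff₀ hσ (by positivity)]
    nlinarith
  have hr4 : r < 1 / (4 * ρ) := hr.trans_le (by
    gcongr
    exact pow_le_one₀ hσ.le (Real.sin_le_one _))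
  set g : M × M → ℝ := fun p => ‖u p.1 - u p.2‖
  have hg : Continuous g :=
    ((hu.continuous.comp continuous_fst).sub (hu.continuous.comp continuous_snd)).norm
  suffices hfar : p ∉ farPairs u ρ α by
    rw [farPairs, notMem_compl_iff] at hfar
    obtain ⟨q, hq, hpq⟩ := mem_iUnion₂.1 (hfar.resolve_left hp)
    exact ⟨q, hq, mem_closedSquare_of_norm_le hu hρ hcurv htrans hα hα0 hq hpq hpr⟩
  intro hfar
  obtain ⟨z, hz, hmin⟩ := (isCompact_farPairs hu hα).exists_isMinOn ⟨p, hfar⟩ hg.continuousOn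
  have hzr : g z ≤ r := (hmin hfar).trans hpr
  -- Pairs outside `farPairs` at distance at most `r` lie in the thinner tube or in the smaller
  -- closed squares, and both stay away from `z`. Hence the minimum over `farPairs` is a local
  -- minimum on `M × M`.
  have hloc : IsLocalMin g z := by
    have h1 : ∀ᶠ y in 𝓝 z, y ∉ tube u (1 / (2 * ρ)) :=
      eventually_notMem_tube hu (by gcongr; linarith) fun h => hz (Or.inl h)
    have h2 : ∀ᶠ y in 𝓝 z, ∀ q ∈ selfIntersectionPairs u,
        y ∉ closedSquare (α q.1) (α q.2) (2 * r / σ) := by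
      refine (eventually_all_finite (finite_selfIntersectionPairs hu hρ hcurv htrans)).2 ?_
      intro q hq
      refine ((hα q.1).isClosed_closedSquare (hα q.2) _).isOpen_compl.mem_nhds fun h => ?_
      exact hz (Or.inr (mem_biUnion hq (closedSquare_subset_square hsmall h)))
    filter_upwards [h1, h2] with y hy1 hy2
    rcases le_or_gt (g y) r with hyr | hyr
    · refine hmin fun hy => ?_
      rcases hy with hy | hy
      · exact hy1 (mem_tube_of_norm_lt hu hρ hcurv hy (hyr.trans_lt hr4))
      · obtain ⟨q, hq, hyq⟩ := mem_iUnion₂.1 hy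
        exact hy2 q hq (mem_closedSquare_of_norm_le hu hρ hcurv htrans hα hα0 hq hyq hyr)
    · exact hzr.trans hyr.le
  obtain ⟨ho1, ho2⟩ := orthogonal_of_isLocalMin_pair hu hloc
  have hzC := notMem_selfIntersectionPairs_of_mem_farPairs hu hρ hcurv htrans hα0 hz
  have hΔ : minCriticalDist u ≤ edist (u z.1) (u z.2) :=
    iInf₂_le z ⟨⟨ne_of_mem_farPairs hu hρ hz, ho2, ho1⟩, hzC⟩
  refine (hΔ.trans ?_).not_gt hrΔ
  rw [edist_dist, dist_eq_norm]
  exact ENNReal.ofReal_le_ofReal hzr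

/-- The slack `r < r'` is there because the infimum in `normalReach` need not be attained: it
supplies a competitor at distance less than `r'`. -/
theorem normalReachSublevel_subset (hu : IsC2Immersion u) (hρ : 0 < ρ)
    (hcurv : CurvatureBoundedBy u ρ) (htrans : TransverseSelfIntersections u)
    (hα : ∀ x, IsArc u (α x) (ν x) univ) (hα0 : ∀ x, α x 0 = x) {r r' : ℝ} (hr0 : 0 ≤ r)
    (hrr' : r < r') (hrΔ : ENNReal.ofReal r' < minCriticalDist u)
    (hr : r' < Real.sin (minAngle u) ^ 2 / (4 * ρ)) :
    normalReachSublevel u r ⊆ ⋃ x ∈ selfIntersectionPoints u,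
      α x '' Icc (-(2 * r' / Real.sin (minAngle u))) (2 * r' / Real.sin (minAngle u)) := by
  intro x hx
  have hlt : normalReach u x < ENNReal.ofReal r' :=
    (show normalReach u x ≤ ENNReal.ofReal r from hx).trans_lt
      ((ENNReal.ofReal_lt_ofReal_iff (hr0.trans_lt hrr')).2 hrr')
  obtain ⟨y, hy⟩ := iInf_lt_iff.1 hlt
  obtain ⟨⟨hyx, horth⟩, hy⟩ := iInf_lt_iff.1 hy
  rw [edist_dist, dist_eq_norm, ENNReal.ofReal_lt_ofReal_iff (hr0.trans_lt hrr')] at hy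
  obtain ⟨q, hq, hxq⟩ := exists_mem_closedSquare hu hρ hcurv htrans hα hα0 hrΔ hr
    (notMem_tube_of_orthogonal hu hρ hcurv hyx.symm horth) hy.le
  refine mem_biUnion ?_ hxq.1
  rw [selfIntersectionPoints_eq hu hρ hcurv]
  exact mem_image_of_mem _ hq

variable [MeasurableSpace M] [BorelSpace M]

theorem measure_normalReachSublevel_le (hu : IsC2Immersion u) (hρ : 0 < ρ)
    (hcurv : CurvatureBoundedBy u ρ) (htrans : TransverseSelfIntersections u) {μ : Measure M}
    {L : ℝ≥0} {fmin fmax : ℝ} (hfmax : 0 < fmax) (hμ : HasLipschitzDensity u μ L fmin fmax)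
    {r r' : ℝ} (hr0 : 0 ≤ r)
    (hrr' : r < r') (hrΔ : ENNReal.ofReal r' < minCriticalDist u)
    (hr : r' < Real.sin (minAngle u) ^ 2 / (4 * ρ)) :
    μ (normalReachSublevel u r) ≤ ENNReal.ofReal (reachConstant u fmax * r') := by
  choose α ν hα hα0 using hu.exists_arc
  have hσ := sin_minAngle_pos hu hρ hcurv htrans
  have hfin : (selfIntersectionPoints u).Finite := by
    rw [selfIntersectionPoints_eq hu hρ hcurv]
    exact (finite_selfIntersectionPairs hu hρ hcurv htrans).image _
  have hsub := normalReachSublevel_subset hu hρ hcurv htrans hα hα0 hr0 hrr' hrΔ hr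
  set σ := Real.sin (minAngle u) with hσdef
  have hσ1 : σ ≤ 1 := Real.sin_le_one _
  have hr'0 : 0 < r' := hr0.trans_lt hrr'
  have hd : 2 * r' / σ < 1 / ρ := by
    rw [lt_div_iff₀ (by positivity)] at hr
    rw [div_lt_div_iff₀ hσ hρ]
    nlinarith
  have hball : ∀ x, μ (α x '' Icc (-(2 * r' / σ)) (2 * r' / σ)) ≤
      ENNReal.ofReal (fmax * (2 * (2 * r' / σ))) := fun x => by
    refine (hμ.measure_le
      (isCompact_Icc.image (hα x).continuous).isClosed.measurableSet).trans ?_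
    rw [ENNReal.ofReal_mul hfmax.le]
    gcongr
    exact (hα x).pullbackHausdorff_image_le hu hρ hcurv hd
  have hfin' : hfin.toFinset.card = (selfIntersectionPoints u).ncard :=
    (ncard_eq_toFinset_card _ hfin).symm
  calc μ (normalReachSublevel u r)
      ≤ μ (⋃ x ∈ hfin.toFinset, α x '' Icc (-(2 * r' / σ)) (2 * r' / σ)) :=
        measure_mono (by simpa using hsub)
    _ ≤ ∑ x ∈ hfin.toFinset, μ (α x '' Icc (-(2 * r' / σ)) (2 * r' / σ)) :=
        measure_biUnion_finset_le _ _
    _ ≤ ∑ x ∈ hfin.toFinset, ENNReal.ofReal (fmax * (2 * (2 * r' / σ))) :=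
        Finset.sum_le_sum fun x _ => hball x
    _ = ENNReal.ofReal ((selfIntersectionPoints u).ncard * (fmax * (2 * (2 * r' / σ)))) := by
        rw [Finset.sum_const, hfin', nsmul_eq_mul,
          ENNReal.ofReal_mul (p := ((selfIntersectionPoints u).ncard : ℝ)) (by positivity),
          ENNReal.ofReal_natCast]
    _ ≤ ENNReal.ofReal (reachConstant u fmax * r') := by
        apply ENNReal.ofReal_le_ofReal
        rw [reachConstant, ← hσdef, Jmax, unitBallVolume]
        -- The argument gives the factor `4`; `reachConstant` has `5 = (5/4) * 2 * 2`, so `Jmax` is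
        -- pure slack.
        have h0 : (0 : ℝ) ≤ (selfIntersectionPoints u).ncard * fmax * (r' / σ) := by positivity
        calc ((selfIntersectionPoints u).ncard : ℝ) * (fmax * (2 * (2 * r' / σ)))
            = 4 * ((selfIntersectionPoints u).ncard * fmax * (r' / σ)) := by ring
          _ ≤ 5 * ((selfIntersectionPoints u).ncard * fmax * (r' / σ)) := by linarith
          _ = _ := by ring

end

end ImmersedCurve

end

/-! ### The theorem. -/

open ImmersedCurve in
theorem proposition2p18 {n : ℕ} {M : Type*} [TopologicalSpace M] [ChartedSpace ℝ M]
    [IsManifold 𝓘(ℝ, ℝ) 2 M] [CompactSpace M] [T2Space M] [MeasurableSpace M] [BorelSpace M]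
    (u : M → Euc n) (hu : IsC2Immersion u)
    (μ₀ : Measure M) [IsProbabilityMeasure μ₀]
    (ρ : ℝ) (hρ : 0 < ρ) (L : ℝ≥0) (fmin fmax : ℝ) (hfmin : 0 < fmin) (hfmax : 0 < fmax)
    (hyp1 : TransverseSelfIntersections u)
    (hyp2 : CurvatureBoundedBy u ρ)
    (hyp3 : HasLipschitzDensity u μ₀ L fmin fmax) :
    (selfIntersectionPoints u).Finite ∧ 0 < minAngle u ∧ 0 < minCriticalDist u ∧
    (∀ r : ℝ, 0 ≤ r → ENNReal.ofReal r < minCriticalDist u →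
      r < Real.sin (minAngle u) ^ 2 / (4 * ρ) →
      μ₀ (normalReachSublevel u r) ≤ ENNReal.ofReal (reachConstant u fmax * r)) ∧
    (∃ c : ℝ, 0 ≤ c ∧ ∃ r₀ : ℝ, 0 < r₀ ∧ ∀ r : ℝ, 0 ≤ r → r < r₀ →
      μ₀ (normalReachSublevel u r) ≤ ENNReal.ofReal (c * r)) := by
  have hfin := finite_selfIntersectionPairs hu hρ hyp2 hyp1
  have hσ := sin_minAngle_pos hu hρ hyp2 hyp1
  have hΔ := minCriticalDist_pos hu hρ hyp2 hyp1
  have hmain : ∀ r : ℝ, 0 ≤ r → ENNReal.ofReal r < minCriticalDist u →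
      r < Real.sin (minAngle u) ^ 2 / (4 * ρ) →
      μ₀ (normalReachSublevel u r) ≤ ENNReal.ofReal (reachConstant u fmax * r) := by
    intro r hr0 hrΔ hr
    have hcont : Filter.Tendsto (fun r' => ENNReal.ofReal (reachConstant u fmax * r'))
        (nhdsWithin r (Ioi r)) (nhds (ENNReal.ofReal (reachConstant u fmax * r))) :=
      ((ENNReal.continuous_ofReal.comp (continuous_const.mul continuous_id)).tendsto r).mono_left
        nhdsWithin_le_nhds
    -- Let `r'` decrease to `r`; the constraints on `r'` are open, so they hold for `r'` near `r`.
    refine ge_of_tendsto hcont ?_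
    have h1 : ∀ᶠ r' in nhds r, ENNReal.ofReal r' < minCriticalDist u :=
      ENNReal.continuous_ofReal.continuousAt.eventually (gt_mem_nhds hrΔ)
    filter_upwards [self_mem_nhdsWithin, nhdsWithin_le_nhds h1,
      nhdsWithin_le_nhds (gt_mem_nhds hr)] with r' hrr' hr'Δ hr'
    exact measure_normalReachSublevel_le hu hρ hyp2 hyp1 hfmax hyp3 hr0 hrr' hr'Δ hr'
  refine ⟨?_, minAngle_pos hu hyp1 hfin, hΔ, hmain, ?_⟩
  · rw [selfIntersectionPoints_eq hu hρ hyp2]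
    exact hfin.image _
  -- `Δ` may be infinite, so a finite positive `δ` below it is used for the real threshold.
  · obtain ⟨δ, hδ0, hδ⟩ := ENNReal.lt_iff_exists_nnreal_btwn.1 hΔ
    refine ⟨reachConstant u fmax, ?_, min δ (Real.sin (minAngle u) ^ 2 / (4 * ρ)),
      lt_min (by exact_mod_cast hδ0) (by positivity), fun r hr0 hr => hmain r hr0 ?_ ?_⟩
    · rw [reachConstant, Jmax, unitBallVolume]
      positivity
    · refine lt_of_le_of_lt ?_ hδ
      rw [← ENNReal.ofReal_coe_nnreal]
      exact ENNReal.ofReal_le_ofReal (hr.le.trans (min_le_left _ _))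
    · exact hr.trans_le (min_le_right _ _)
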